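/- Let $D$ be a diagram of a nonempty oriented link $K$, with $c_+$ positive and $c_-$ negative crossings and writhe $w=w(D)=c_+-c_-$. Let $v_A$ and $v_B$ be the numbers of circles obtained from $D$ by resolving every crossing with the $A$-resolution, respectively with the $B$-resolution. The all-$A$ state graph $\mathbb G_A$ (all-$B$ state graph $\mathbb G_B$) has these circles as vertices and one edge for each crossing, joining the circles that contain the two arcs of the resolved crossing; $D$ is called $A$-adequate ($B$-adequate) if $\mathbb G_A$ ($\mathbb G_B$) has no one-edge loops. For $m\ge 0$ let $D^m$ be the blackboard $m$-cable of $D$ (that is, $m$ parallel copies of $D$; $D^0$ is the empty diagram), and let $\langle\cdot\rangle$ be the Kauffman bracket, normalized to be $1$ on the crossingless diagram of the unknot, so that $$\langle E\rangle=\sum_{\sigma}A^{a(\sigma)-b(\sigma)}(-A^2-A^{-2})^{|\sigma|-1}\in\mathbb Q(A),$$ where $\sigma$ runs over the Kauffman states of the diagram $E$, $a(\sigma)$ and $b(\sigma)$ are the numbers of $A$- and $B$-resolutions and $|\sigma|$ is the number of state circles. Define $S_0(x)=1$, $S_1(x)=x$, $S_{n+1}(x)=xS_n(x)-S_{n-1}(x)$,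 write $S_n(x)=\sum_k s_{n,k}x^k$, and put $$\langle S_n(D)\rangle=\sum_k s_{n,k}\langle D^k\rangle,\qquad G_D(n+1,A)=\left((-1)^nA^{n^2+2n}\right)^{-w}(-1)^{n-1}\langle S_n(D)\rangle .$$ Let $d(n)$ and $d^*(n)$ be the maximum and the minimum degree of $G_D(n+1,A)$ in $A$ (for a rational function: the degree at $\infty$ and the order at $0$), and let $$h_n(D)=2c_-n^2+2(v_A-w)n-2,\qquad h_n^*(D)=-\left(2c_+n^2+2(v_B+w)n-2\right).$$ Then: 1. $D$ is $A$-adequate if and only if $d(n)=h_n(D)$ for some $n\ge 2$. Moreover, $d(n)=h_n(D)$ for every $n\ge 2$ if and only if $d(2)=h_2(D)$. 2. $D$ is $B$-adequate if and only if $d^*(n)=h^*_n(D)$ for some $n\ge 2$. Moreover, $d^*(n)=h^*_n(D)$ for every $n\ge 2$ if and only if $d^*(2)=h^*_2(D)$. -/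

import Mathlib

namespace LinkDiag

noncomputable section

/-- Unoriented diagram data (a planar diagram code): finitely many crossings, whose ends are glued
in pairs by the edges of the diagram, and a number of crossingless closed curves.
The four ends of a crossing `x` are `(x, 0), (x, 1), (x, 2), (x, 3)` in counterclockwise order;
`(x, 0)` and `(x, 2)` are the ends of the under-strand, `(x, 1)` and `(x, 3)` those of the
over-strand. -/
structure Diagram where
  Crossing : Type
  [fintypeCrossing : Fintype Crossing]
  [decEqCrossing : DecidableEq Crossing]
  glue : Crossing × Fin 4 → Crossing × Fin 4
  glue_glue : ∀ d, glue (glue d) = d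
  glue_ne : ∀ d, glue d ≠ d
  freeCircles : ℕ

attribute [instance] Diagram.fintypeCrossing Diagram.decEqCrossing

/-- The other end of the smoothing arc at an end. Draw the under-strand from south (end 0) to
north (end 2) and the over-strand from east (1) to west (3). Turning the over-strand
counterclockwise sweeps out the north-east and south-west regions; the A-resolution (`true`)
merges these two, so its arcs join 0 to 1 and 2 to 3. The arcs of the B-resolution (`false`)
join 0 to 3 and 1 to 2. -/
def smoothEnd : Bool → Fin 4 → Fin 4
  | true => ![1, 0, 3, 2]
  | false => ![3, 2, 1, 0]

namespace Diagram

variable (D : Diagram)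

/-- The ends of the crossings. -/
abbrev End : Type := D.Crossing × Fin 4

/-- A Kauffman state: a choice of the A-resolution (`true`) or the B-resolution (`false`) at each
crossing. -/
abbrev State : Type := D.Crossing → Bool

/-- One step along a state circle: along an edge of the diagram or along a smoothing arc. -/
def StateStep (s : D.State) (d e : D.End) : Prop :=
  e = D.glue d ∨ e = (d.1, smoothEnd (s d.1) d.2)

/-- The circles of the curve system obtained by applying the state `s`. -/
abbrev StateCircle (s : D.State) : Type := Quot (D.StateStep s) ⊕ Fin D.freeCircles

/-- The state circle through a given end. -/
def circleAt (s : D.State) (d : D.End) : D.StateCircle s := Sum.inl (Quot.mk _ d)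

/-- The number of state circles. -/
def circleCount (s : D.State) : ℕ := Nat.card (D.StateCircle s)

/-- The state graph has the state circles as vertices and the crossings as edges. This is the
pair of endpoints of the edge `x`: the circles containing the two smoothing arcs at `x`. For both
resolutions the ends 0 and 2 lie on different arcs. -/
def edgeEnds (s : D.State) (x : D.Crossing) : Sym2 (D.StateCircle s) :=
  s(D.circleAt s (x, 0), D.circleAt s (x, 2))

/-- The all-A state. -/
def allA : D.State := fun _ => true

/-- The all-B state. -/
def allB : D.State := fun _ => false

/-- A-adequate: the state graph of the all-A state has no one-edge loop. -/
def AAdequate : Prop := ∀ x : D.Crossing, ¬ (D.edgeEnds D.allA x).IsDiag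

/-- B-adequate: the state graph of the all-B state has no one-edge loop. -/
def BAdequate : Prop := ∀ x : D.Crossing, ¬ (D.edgeEnds D.allB x).IsDiag

/-- The number of A-resolutions minus the number of B-resolutions. -/
def stateExponent (s : D.State) : ℤ := ∑ x : D.Crossing, if s x then 1 else -1

/-- The Kauffman bracket, with value 1 on the crossingless diagram of the unknot, hence
`(-A ^ 2 - A ^ (-2))⁻¹` on the empty diagram, as a rational function in `A = RatFunc.X`. -/
def bracket : RatFunc ℚ :=
  ∑ s : D.State, (RatFunc.X : RatFunc ℚ) ^ D.stateExponent s *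
    (-RatFunc.X ^ 2 - RatFunc.X ^ (-2 : ℤ)) ^ ((D.circleCount s : ℤ) - 1)

/-- The number of faces of the four-valent graph with the given cyclic orders at its vertices:
the orbits of "cross the edge, then turn to the next end". -/
def faceCount : ℕ :=
  Nat.card (Quot fun d e : D.End => e = ((D.glue d).1, (D.glue d).2 + 1))

/-- The number of connected components of the four-valent graph. -/
def graphComponentCount : ℕ :=
  Nat.card (Quot fun x y : D.Crossing => ∃ i : Fin 4, y = (D.glue (x, i)).1)

/-- The four-valent graph, with its cyclic orders, is a plane (equivalently, spherical) graph:
vertices - edges + faces = 2 * components. Every component has Euler characteristic at most two,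
so this says that every component is a plane graph. -/
def IsPlanar : Prop :=
  (Fintype.card D.Crossing : ℤ) - 2 * Fintype.card D.Crossing + D.faceCount =
    2 * D.graphComponentCount

end Diagram

/-- In an `m`-cable a crossing is replaced by an `m` by `m` grid of crossings. The grid cell
`(p, q)` lies in column `p` (counted from west to east) and row `q` (from south to north).
Looked at from side `k` (south, east, north, west for `k = 0, 1, 2, 3`), a cell also has
coordinates `(i, j)`: it lies on the `i`-th of the `m` strands that enter through that side, in
counterclockwise order, and it is the `j`-th crossing met on the way in. This is the change of
coordinates from `(i, j)` to `(p, q)`. -/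
def gridCell (m : ℕ) : Fin 4 → Fin m × Fin m → Fin m × Fin m
  | 0, (i, j) => (i, j)
  | 1, (i, j) => (j.rev, i)
  | 2, (i, j) => (i.rev, j.rev)
  | 3, (i, j) => (j, i.rev)

/-- The inverse change of coordinates, from `(p, q)` to `(i, j)`. -/
def gridCoord (m : ℕ) : Fin 4 → Fin m × Fin m → Fin m × Fin m
  | 0, (p, q) => (p, q)
  | 1, (p, q) => (q, p.rev)
  | 2, (p, q) => (p.rev, q.rev)
  | 3, (p, q) => (q.rev, p)

theorem gridCell_gridCoord (m : ℕ) (k : Fin 4) (c : Fin m × Fin m) :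
    gridCell m k (gridCoord m k c) = c := by
  fin_cases k <;> simp [gridCell, gridCoord]

theorem gridCoord_gridCell (m : ℕ) (k : Fin 4) (c : Fin m × Fin m) :
    gridCoord m k (gridCell m k c) = c := by
  fin_cases k <;> simp [gridCell, gridCoord]

theorem gridCoord_add_two (m : ℕ) (k : Fin 4) (c : Fin m × Fin m) :
    gridCoord m (k + 2) c = ((gridCoord m k c).1.rev, (gridCoord m k c).2.rev) := by
  fin_cases k <;> simp [gridCoord]

theorem gridCell_add_two (m : ℕ) (k : Fin 4) (c : Fin m × Fin m) :
    gridCell m (k + 2) (c.1.rev, c.2.rev) = gridCell m k c := by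
  fin_cases k <;> simp [gridCell]

namespace Diagram

variable (D : Diagram)

/-- The gluing of the `m`-cable. From side `k` of a cell with coordinates `(i, j)` as seen from
that side: if `j = 0`, the strand leaves the grid and runs parallel to the edge of `D` there; it
enters the grid at the other end of that edge as the strand number `m - 1 - i`, since the
counterclockwise orders at the two ends of an edge are opposite. If `j > 0`, it runs to the
opposite side of the neighbouring cell `(i, j - 1)`. -/
def cableGlue (m : ℕ) (d : (D.Crossing × Fin m × Fin m) × Fin 4) :
    (D.Crossing × Fin m × Fin m) × Fin 4 :=
  let ij := gridCoord m d.2 d.1.2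
  if (ij.2 : ℕ) = 0 then
    let e := D.glue (d.1.1, d.2)
    ((e.1, gridCell m e.2 (ij.1.rev, ij.2)), e.2)
  else
    ((d.1.1, gridCell m d.2 (ij.1, ⟨ij.2 - 1, by omega⟩)), d.2 + 2)

theorem cableGlue_cableGlue (m : ℕ) (d : (D.Crossing × Fin m × Fin m) × Fin 4) :
    D.cableGlue m (D.cableGlue m d) = d := by
  obtain ⟨⟨x, c⟩, k⟩ := d
  obtain ⟨⟨i, j⟩, rfl⟩ : ∃ ij, gridCell m k ij = c := ⟨_, gridCell_gridCoord m k c⟩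
  by_cases hj : (j : ℕ) = 0
  · have hg := D.glue_glue (x, k)
    simp [cableGlue, gridCoord_gridCell, hj, hg]
  · have h2 : ¬ m - ((j : ℕ) - 1 + 1) = 0 := by omega
    have h4 : k + 2 + 2 = k := by fin_cases k <;> rfl
    have h5 : (⟨m - ((j : ℕ) - 1 + 1) - 1, by omega⟩ : Fin m) = j.rev := by
      ext; simp [Fin.val_rev]; omega
    have h6 := gridCell_add_two m k (i, j)
    simp only [cableGlue, gridCoord_gridCell, gridCoord_add_two, hj, if_false, Fin.val_rev, h2, h4,
      h5]
    simpa using h6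

theorem cableGlue_ne (m : ℕ) (d : (D.Crossing × Fin m × Fin m) × Fin 4) :
    D.cableGlue m d ≠ d := by
  obtain ⟨⟨x, c⟩, k⟩ := d
  intro h
  simp only [cableGlue] at h
  split_ifs at h with h0
  · apply D.glue_ne (x, k)
    simp only [Prod.mk.injEq] at h
    exact Prod.ext h.1.1 h.2
  · have := congrArg Prod.snd h
    revert this
    fin_cases k <;> simp

/-- The blackboard `m`-cable, that is, `m` parallel copies of the diagram. -/
def cable (m : ℕ) : Diagram where
  Crossing := D.Crossing × Fin m × Fin m
  glue := D.cableGlue m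
  glue_glue := D.cableGlue_cableGlue m
  glue_ne := D.cableGlue_ne m
  freeCircles := m * D.freeCircles

/-- The bracket of `S_n(D)`: in the Chebyshev polynomial `S_n(x)`, with `S_0 = 1`, `S_1 = x` and
`S_{n+1} = x S_n - S_{n-1}`, each power `x ^ k` is replaced by the bracket of the `k`-cable. -/
def chebyshevBracket (n : ℕ) : RatFunc ℚ :=
  (Polynomial.Chebyshev.S ℤ n).sum fun k a => (a : RatFunc ℚ) * (D.cable k).bracket

end Diagram

/-- The maximum degree of a rational function in its variable (degree of the numerator minus degree
of the denominator); for Laurent polynomials this is the largest exponent. -/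
def maxDegree (f : RatFunc ℚ) : WithBot ℤ :=
  open Classical in if f = 0 then ⊥ else ((f.intDegree : ℤ) : WithBot ℤ)

/-- The minimum degree of a rational function in its variable (its order at zero); for Laurent
polynomials this is the smallest exponent. -/
def minDegree (f : RatFunc ℚ) : WithTop ℤ :=
  open Classical in
  if f = 0 then ⊤ else
    (((f.num.natTrailingDegree : ℤ) - (f.denom.natTrailingDegree : ℤ) : ℤ) : WithTop ℤ)

/-- A diagram of an oriented, nonempty link: plane diagram data with an orientation, which says at
which ends of a crossing the strands point away from the crossing. (Crossingless curves may be
oriented arbitrarily; nothing depends on it.) -/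
structure LinkDiagram extends Diagram where
  outgoing : Crossing × Fin 4 → Bool
  outgoing_opposite : ∀ (x : Crossing) (i : Fin 4), outgoing (x, i + 2) = !outgoing (x, i)
  outgoing_glue : ∀ d, outgoing (glue d) = !outgoing d
  planar : toDiagram.IsPlanar
  nonempty : Nonempty Crossing ∨ 0 < freeCircles

namespace LinkDiagram

variable (D : LinkDiagram)

/-- A crossing is positive when the direction of the under-strand is obtained from that of the
over-strand by a counterclockwise quarter turn: up to a half turn of the picture, the strands run
from end 0 to end 2 and from end 3 to end 1. -/
def IsPositive (x : D.Crossing) : Prop := D.outgoing (x, 1) = D.outgoing (x, 2)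

/-- The number of positive crossings. -/
def cPos : ℕ := Nat.card {x : D.Crossing // D.IsPositive x}

/-- The number of negative crossings. -/
def cNeg : ℕ := Nat.card {x : D.Crossing // ¬ D.IsPositive x}

/-- The writhe. -/
def writhe : ℤ := (D.cPos : ℤ) - D.cNeg

/-- The number of circles of the all-A state. -/
def vA : ℕ := D.circleCount D.allA

/-- The number of circles of the all-B state. -/
def vB : ℕ := D.circleCount D.allB

/-- The unreduced colored Jones polynomial `G_D(n + 1, A)`. -/
def G (n : ℕ) : RatFunc ℚ :=
  ((-1) ^ n * RatFunc.X ^ (n ^ 2 + 2 * n)) ^ (-D.writhe) * (-1) ^ ((n : ℤ) - 1) *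
    D.chebyshevBracket n

/-- The maximum degree of `G_D(n + 1, A)` in `A`. -/
def dMax (n : ℕ) : WithBot ℤ := maxDegree (D.G n)

/-- The minimum degree of `G_D(n + 1, A)` in `A`. -/
def dMin (n : ℕ) : WithTop ℤ := minDegree (D.G n)

/-- The diagrammatic upper bound for the maximum degree. -/
def hMax (n : ℕ) : ℤ := 2 * D.cNeg * n ^ 2 + 2 * (D.vA - D.writhe) * n - 2

/-- The diagrammatic lower bound for the minimum degree: minus the upper bound for the mirror
image, which has `cPos` negative crossings, `vB` all-A circles and writhe `-writhe`. -/
def hMin (n : ℕ) : ℤ := -(2 * D.cPos * n ^ 2 + 2 * (D.vB + D.writhe) * n - 2)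

end LinkDiagram

end

end LinkDiag

namespace LinkDiag

/-! Let `c` be the number of crossings. A state with `b` B-resolutions contributes a term of degree
`c - 2b + 2|σ| - 2` to the bracket. Switching one crossing changes the number of circles by exactly
one, so `|σ| ≤ v_A + b`, and no state exceeds the degree `degreeBound` of the all-A state. A state
that switches a crossing which is not a loop of the all-A state graph merges two circles at that
switch and stays strictly below the bound (`circleCount_add_two_le`). Only states whose
B-resolutions all lie at loops can therefore reach the top degree.

If `D` is A-adequate, so are its cables, and the all-A state alone attains the bound. If `D` is not
A-adequate and `n ≥ 2`, the `n`-cable has a crossing `z` that remains a loop in every state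
switching only loops other than `z` (`exists_persistent_loop`). Switching `z` then multiplies a
weight by `A⁻²(-A² - A⁻²) = -1 - A⁻⁴`, so the top terms cancel in pairs
(`degreeValuation_bracket_lt`).

The crossing `z` comes from planarity. Loops attached to a state circle from one side are disjoint
chords of a disc, so switching one does not destroy another (`sameCircle_of_loops`, by a Jordan
curve argument modulo 2). Loops on opposite sides may interfere in `D`; in a cable with at least two
strands they sit on different parallel copies of the circle (`sameCircle_cable_corner`).

Lower cables in `S_n(D)` have strictly smaller degree bounds, and the writhe factor only shifts
degrees. Hence for each `n ≥ 2` the equality `d(n) = h_n(D)` is equivalent to A-adequacy, a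
condition independent of `n`. The B-statements follow by taking mirror images, which substitutes
`A⁻¹` for `A`. -/

theorem smoothEnd_smoothEnd (b : Bool) (i : Fin 4) : smoothEnd b (smoothEnd b i) = i := by
  cases b <;> fin_cases i <;> rfl

/-! ### State circles, checkerboard colourings, and switching one crossing. -/

namespace Diagram

variable (D : Diagram)

/-- A checkerboard colouring of the regions, read as a function on ends: the colour of the region
between an end and its counterclockwise successor. -/
def IsColoring (χ : D.End → Bool) : Prop :=
  (∀ x i, χ (x, i + 1) = !χ (x, i)) ∧ ∀ d, χ (D.glue d) = !χ d

/-- Two ends lie on the same state circle. -/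
def SameCircle (s : D.State) (d e : D.End) : Prop :=
  Quot.mk (D.StateStep s) d = Quot.mk (D.StateStep s) e

/-- The other end of the smoothing arc at an end, in a given state. -/
def smooth (s : D.State) (d : D.End) : D.End := (d.1, smoothEnd (s d.1) d.2)

variable {D}

theorem IsColoring.not {χ : D.End → Bool} (h : D.IsColoring χ) : D.IsColoring fun d => !χ d :=
  ⟨fun x i => congrArg (! ·) (h.1 x i), fun d => congrArg (! ·) (h.2 d)⟩

theorem IsColoring.apply_one {χ : D.End → Bool} (h : D.IsColoring χ) (x : D.Crossing) :
    χ (x, 1) = !χ (x, 0) := h.1 x 0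

theorem IsColoring.apply_two {χ : D.End → Bool} (h : D.IsColoring χ) (x : D.Crossing) :
    χ (x, 2) = χ (x, 0) := by
  have := h.1 x 1
  rw [h.apply_one] at this
  simpa using this

theorem IsColoring.apply_three {χ : D.End → Bool} (h : D.IsColoring χ) (x : D.Crossing) :
    χ (x, 3) = !χ (x, 0) := by
  have := h.1 x 2
  rw [h.apply_two] at this
  simpa using this

theorem IsColoring.smooth {χ : D.End → Bool} (h : D.IsColoring χ) (s : D.State) (d : D.End) :
    χ (D.smooth s d) = !χ d := by
  obtain ⟨x, i⟩ := d
  have h1 := h.apply_one x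
  have h2 := h.apply_two x
  have h3 := h.apply_three x
  cases hs : s x <;> fin_cases i <;> simp_all [Diagram.smooth, smoothEnd]

theorem smooth_smooth (s : D.State) (d : D.End) : D.smooth s (D.smooth s d) = d := by
  simp [smooth, smoothEnd_smoothEnd]

section SameCircle

variable {s : D.State} {d e f : D.End}

theorem SameCircle.symm (h : D.SameCircle s d e) : D.SameCircle s e d := Eq.symm h

theorem SameCircle.trans (h : D.SameCircle s d e) (h' : D.SameCircle s e f) :
    D.SameCircle s d f := Eq.trans h h'

theorem sameCircle_glue (s : D.State) (d : D.End) : D.SameCircle s d (D.glue d) :=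
  Quot.sound (Or.inl rfl)

theorem sameCircle_smooth (s : D.State) (d : D.End) : D.SameCircle s d (D.smooth s d) :=
  Quot.sound (Or.inr rfl)

/-- A function on ends that is preserved by all steps is constant on state circles. -/
theorem SameCircle.map_eq {α : Sort*} {g : D.End → α} (h : D.SameCircle s d e)
    (hglue : ∀ d, g (D.glue d) = g d) (hsmooth : ∀ d, g (D.smooth s d) = g d) : g d = g e := by
  refine congrArg (Quot.lift g ?_) h
  rintro a b (rfl | rfl)
  · exact (hglue a).symm
  · exact (hsmooth a).symm

/-- A map of ends that sends steps to connected pairs of ends preserves connectedness. -/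
theorem SameCircle.map_sameCircle {D' : Diagram} {s' : D'.State} {g : D.End → D'.End}
    (h : D.SameCircle s d e) (hglue : ∀ d, D'.SameCircle s' (g (D.glue d)) (g d))
    (hsmooth : ∀ d, D'.SameCircle s' (g (D.smooth s d)) (g d)) : D'.SameCircle s' (g d) (g e) :=
  h.map_eq (g := fun d => Quot.mk (D'.StateStep s') (g d)) hglue hsmooth

theorem sameCircle_zero_one {x : D.Crossing} (h : s x = true) :
    D.SameCircle s (x, 0) (x, 1) := by
  simpa [smooth, h, smoothEnd] using sameCircle_smooth s (x, 0)

theorem sameCircle_two_three {x : D.Crossing} (h : s x = true) :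
    D.SameCircle s (x, 2) (x, 3) := by
  simpa [smooth, h, smoothEnd] using sameCircle_smooth s (x, 2)

theorem sameCircle_zero_three {x : D.Crossing} (h : s x = false) :
    D.SameCircle s (x, 0) (x, 3) := by
  simpa [smooth, h, smoothEnd] using sameCircle_smooth s (x, 0)

theorem sameCircle_one_two {x : D.Crossing} (h : s x = false) :
    D.SameCircle s (x, 1) (x, 2) := by
  simpa [smooth, h, smoothEnd] using sameCircle_smooth s (x, 1)

end SameCircle

/-- Follow the strand from the end `(x, 0)` until it first returns to `x`: it does so at the end
`(x, 1)` or at the end `(x, 3)`, and this decides which resolution of `x` puts both smoothing arcs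
on one circle. -/
theorem exists_sameCircle_iff {χ : D.End → Bool} (hχ : D.IsColoring χ) (s : D.State)
    (x : D.Crossing) : ∃ b : Bool, ∀ t : D.State, (∀ y, y ≠ x → t y = s y) →
      (D.SameCircle t (x, 0) (x, 2) ↔ t x ≠ b) := by
  set π : D.End → D.End := fun d => D.smooth s (D.glue d) with hπ
  set a : D.End := (x, 0) with ha
  have hinj : Function.Injective π := by
    intro d e h
    have := congrArg (fun d => D.glue (D.smooth s d)) h
    simpa [hπ, smooth_smooth, D.glue_glue] using this
  -- An injective self-map of a finite set is periodic at `a`. The last step of the period is a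
  -- smoothing, which does not change the crossing, so the glued end before it already lies at `x`.
  have hreturn : ∃ k, (D.glue (π^[k] a)).1 = x := by
    obtain ⟨n, hn, hper⟩ := hinj.mem_periodicPts a
    obtain ⟨k, rfl⟩ : ∃ k, n = k + 1 := ⟨n - 1, by omega⟩
    refine ⟨k, ?_⟩
    have h : π^[k + 1] a = a := hper
    rw [Function.iterate_succ_apply'] at h
    exact congrArg Prod.fst h
  classical
  set k := Nat.find hreturn with hk
  have hkx : (D.glue (π^[k] a)).1 = x := Nat.find_spec hreturn
  have hmin : ∀ j < k, (D.glue (π^[j] a)).1 ≠ x := fun j hj => Nat.find_min hreturn hj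
  set e := D.glue (π^[k] a) with he
  have hχπ : ∀ j, χ (π^[j] a) = χ a := by
    intro j
    induction j with
    | zero => rfl
    | succ j ih =>
      rw [Function.iterate_succ_apply', ← ih]
      simp [hπ, hχ.smooth, hχ.2]
  -- The colour excludes a return at end 2, which has the colour of end 0. This is why a switch
  -- always changes the number of circles.
  have hχe : χ e = !χ a := by rw [he, hχ.2, hχπ]
  have hends : ∀ d : D.End, d.1 = x → χ d = !χ a → d = (x, 1) ∨ d = (x, 3) := by
    rintro ⟨y, i⟩ rfl hd
    have h2 := hχ.apply_two y
    fin_cases i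
    · simp [ha] at hd
    · exact Or.inl rfl
    · simp [ha, h2] at hd
    · exact Or.inr rfl
  have hecase : e = (x, 1) ∨ e = (x, 3) := hends e hkx hχe
  -- `W` is the strand from `a` to its first return `e`. It meets `x` only in these two ends, so if
  -- the smoothing at `x` joins them, `W` closes up to a whole circle missing `(x, 2)`.
  let W : D.End → Prop := fun d => ∃ j ≤ k, d = π^[j] a ∨ d = D.glue (π^[j] a)
  have hWx : ∀ d, W d → d.1 = x → d = a ∨ d = e := by
    rintro d ⟨j, hj, rfl | rfl⟩ hd
    · left
      rcases j with _ | j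
      · rfl
      · rw [Function.iterate_succ_apply'] at hd
        exact absurd hd (hmin j (by omega))
    · right
      rcases hj.lt_or_eq with h | h
      · exact absurd hd (hmin j h)
      · rw [h]
  have hWglue : ∀ d, W d → W (D.glue d) := by
    rintro d ⟨j, hj, rfl | rfl⟩
    · exact ⟨j, hj, Or.inr rfl⟩
    · exact ⟨j, hj, Or.inl (D.glue_glue _)⟩
  have hWsmooth : ∀ d, W d → d.1 ≠ x → W (D.smooth s d) := by
    rintro d ⟨j, hj, rfl | rfl⟩ hd
    · rcases j with _ | j
      · exact absurd rfl hd
      · refine ⟨j, by omega, Or.inr ?_⟩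
        rw [Function.iterate_succ_apply', hπ]
        simp [smooth_smooth]
    · have : j ≠ k := fun h => hd (by rw [h]; exact hkx)
      refine ⟨j + 1, by omega, Or.inl ?_⟩
      rw [Function.iterate_succ_apply']
  have hWa : W a := ⟨0, by omega, Or.inl rfl⟩
  have hWe : W e := ⟨k, le_rfl, Or.inr rfl⟩
  have hsm : ∀ t : D.State, (∀ y, y ≠ x → t y = s y) → ∀ d : D.End, d.1 ≠ x →
      D.smooth t d = D.smooth s d := by
    intro t ht d hd
    simp [smooth, ht _ hd]
  have hpath : ∀ t : D.State, (∀ y, y ≠ x → t y = s y) → D.SameCircle t a e := by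
    intro t ht
    have : ∀ j ≤ k, D.SameCircle t a (π^[j] a) := by
      intro j
      induction j with
      | zero => intro _; rfl
      | succ j ih =>
        intro hj
        refine (ih (by omega)).trans ((sameCircle_glue t _).trans ?_)
        rw [Function.iterate_succ_apply']
        have := sameCircle_smooth t (D.glue (π^[j] a))
        rwa [hsm t ht _ (hmin j (by omega))] at this
    exact (this k le_rfl).trans (sameCircle_glue t _)
  have hsep : ∀ t : D.State, (∀ y, y ≠ x → t y = s y) → D.smooth t a = e →
      ¬ D.SameCircle t a (x, 2) := by
    intro t ht hae h
    have hcl : ∀ d, W d → W (D.smooth t d) := by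
      intro d hd
      by_cases hdx : d.1 = x
      · rcases hWx d hd hdx with rfl | rfl
        · rwa [hae]
        · rwa [← hae, smooth_smooth]
      · rw [hsm t ht d hdx]
        exact hWsmooth d hd hdx
    have hW2 : W (x, 2) := by
      refine cast (h.map_eq (g := W) (fun d => propext ⟨fun h => ?_, hWglue d⟩)
        fun d => propext ⟨fun h => ?_, hcl d⟩) hWa
      · simpa [D.glue_glue] using hWglue _ h
      · simpa [smooth_smooth] using hcl _ h
    rcases hWx _ hW2 rfl with h | h
    · simp [ha] at h
    · rcases hecase with h' | h' <;> simp [h'] at h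
  rcases hecase with h1 | h3
  · refine ⟨true, fun t ht => ?_⟩
    cases htx : t x
    · simpa using (hpath t ht).trans (h1 ▸ sameCircle_one_two htx)
    · simpa using hsep t ht (by simp [smooth, ha, htx, smoothEnd, h1])
  · refine ⟨false, fun t ht => ?_⟩
    cases htx : t x
    · simpa using hsep t ht (by simp [smooth, ha, htx, smoothEnd, h3])
    · simpa using (hpath t ht).trans (h3 ▸ (sameCircle_two_three htx).symm)

/-- The state with the resolution of one crossing switched. -/
def toggle (s : D.State) (x : D.Crossing) : D.State := Function.update s x (!s x)

theorem toggle_self (s : D.State) (x : D.Crossing) : toggle s x x = !s x := by simp [toggle]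

theorem toggle_of_ne (s : D.State) {x y : D.Crossing} (h : y ≠ x) : toggle s x y = s y := by
  simp [toggle, h]

theorem toggle_toggle (s : D.State) (x : D.Crossing) : toggle (toggle s x) x = s := by
  simp [toggle]

theorem sameCircle_toggle_iff {χ : D.End → Bool} (hχ : D.IsColoring χ) (s : D.State)
    (x : D.Crossing) :
    D.SameCircle (toggle s x) (x, 0) (x, 2) ↔ ¬ D.SameCircle s (x, 0) (x, 2) := by
  obtain ⟨b, hb⟩ := exists_sameCircle_iff hχ s x
  rw [hb s fun _ _ => rfl, hb _ fun y hy => toggle_of_ne s hy, toggle_self]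
  cases s x <;> cases b <;> simp

theorem sameCircle_of_zero_two {s : D.State} {x : D.Crossing} (h : D.SameCircle s (x, 0) (x, 2))
    (i : Fin 4) : D.SameCircle s (x, 0) (x, i) := by
  cases hs : s x <;> fin_cases i
  · rfl
  · exact h.trans (sameCircle_one_two hs).symm
  · exact h
  · exact sameCircle_zero_three hs
  · rfl
  · exact sameCircle_zero_one hs
  · exact h
  · exact h.trans (sameCircle_two_three hs)

theorem sameCircle_zero_or_two (s : D.State) (x : D.Crossing) (i : Fin 4) :
    D.SameCircle s (x, 0) (x, i) ∨ D.SameCircle s (x, 2) (x, i) := by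
  cases hs : s x <;> fin_cases i
  · exact Or.inl rfl
  · exact Or.inr (sameCircle_one_two hs).symm
  · exact Or.inr rfl
  · exact Or.inl (sameCircle_zero_three hs)
  · exact Or.inl rfl
  · exact Or.inl (sameCircle_zero_one hs)
  · exact Or.inr rfl
  · exact Or.inr (sameCircle_two_three hs)

/-- If switching `x` merges two circles, nothing that was connected gets disconnected. -/
theorem SameCircle.toggle_of_sameCircle {s : D.State} {x : D.Crossing} {d e : D.End}
    (h : D.SameCircle s d e) (hx : D.SameCircle (toggle s x) (x, 0) (x, 2)) :
    D.SameCircle (toggle s x) d e := by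
  refine h.map_sameCircle (g := id) (fun d => (sameCircle_glue _ d).symm) fun d => ?_
  by_cases hd : d.1 = x
  · obtain ⟨y, i⟩ := d
    obtain rfl : y = x := hd
    exact (sameCircle_of_zero_two hx _).symm.trans (sameCircle_of_zero_two hx i)
  · have := (sameCircle_smooth (toggle s x) d).symm
    rwa [smooth, toggle_of_ne s hd] at this

/-- If switching `x` splits a circle, the connections that get lost are only those between the
two pieces of that circle. -/
theorem SameCircle.of_toggle {s : D.State} {x : D.Crossing} {d e : D.End}
    (h : D.SameCircle (toggle s x) d e) : D.SameCircle s d e ∨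
      (D.SameCircle s (x, 0) d ∧ D.SameCircle s (x, 2) e) ∨
      (D.SameCircle s (x, 2) d ∧ D.SameCircle s (x, 0) e) := by
  classical
  -- Identifying the at most two circles through `x` makes the difference between the two smoothings
  -- at `x` invisible, so `g` is constant on circles of either state.
  let p : D.End → Prop := fun d => D.SameCircle s (x, 0) d ∨ D.SameCircle s (x, 2) d
  let g : D.End → Quot (D.StateStep s) := fun d =>
    if p d then Quot.mk _ (x, 0) else Quot.mk _ d
  have hp : ∀ i, p (x, i) := sameCircle_zero_or_two s x
  have hpc : ∀ {d e}, D.SameCircle s d e → g e = g d := by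
    intro d e h
    have : p d ↔ p e := or_congr ⟨(·.trans h), (·.trans h.symm)⟩ ⟨(·.trans h), (·.trans h.symm)⟩
    simp only [g, this]
    split_ifs
    · rfl
    · exact h.symm
  have hg : g d = g e := by
    refine h.map_eq (fun d => hpc (sameCircle_glue s d)) fun d => ?_
    by_cases hd : d.1 = x
    · obtain ⟨y, i⟩ := d
      obtain rfl : y = x := hd
      simp [g, hp, smooth]
    · have h' : D.smooth (toggle s x) d = D.smooth s d := by simp [smooth, toggle_of_ne s hd]
      rw [h']
      exact hpc (sameCircle_smooth s d)
  by_cases hd : p d <;> by_cases he : p e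
  · rcases hd with hd | hd <;> rcases he with he | he
    · exact Or.inl (hd.symm.trans he)
    · exact Or.inr (Or.inl ⟨hd, he⟩)
    · exact Or.inr (Or.inr ⟨hd, he⟩)
    · exact Or.inl (hd.symm.trans he)
  · simp only [g, hd, he, if_true, if_false] at hg
    exact absurd (Or.inl hg) he
  · simp only [g, hd, he, if_true, if_false] at hg
    exact absurd (Or.inl hg.symm) hd
  · simp only [g, hd, he, if_false] at hg
    exact Or.inl hg

instance (s : D.State) : Finite (Quot (D.StateStep s)) :=
  Finite.of_surjective (Quot.mk _) Quot.mk_surjective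

theorem circleCount_eq (s : D.State) :
    D.circleCount s = Nat.card (Quot (D.StateStep s)) + D.freeCircles := by
  simp [circleCount, Nat.card_sum]

/-- Switching a crossing whose smoothing arcs lie on different circles merges these circles. -/
theorem circleCount_toggle_of_not_sameCircle {χ : D.End → Bool} (hχ : D.IsColoring χ)
    {s : D.State} {x : D.Crossing} (h : ¬ D.SameCircle s (x, 0) (x, 2)) :
    D.circleCount (toggle s x) + 1 = D.circleCount s := by
  have hx := (sameCircle_toggle_iff hχ s x).2 h
  have hlift : ∀ d e, D.StateStep s d e → Quot.mk (D.StateStep (toggle s x)) d = Quot.mk _ e :=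
    fun d e hde => SameCircle.toggle_of_sameCircle (Quot.sound hde) hx
  let f : {c : Quot (D.StateStep s) // c ≠ Quot.mk _ (x, 2)} → Quot (D.StateStep (toggle s x)) :=
    fun c => Quot.lift (Quot.mk _) hlift c.1
  -- The circles of `(x, 0)` and `(x, 2)` become one. Omitting the second leaves one representative
  -- for each new circle.
  have hf : Function.Bijective f := by
    constructor
    · rintro ⟨⟨d⟩, hd⟩ ⟨⟨e⟩, he⟩ hde
      have hde' : D.SameCircle (toggle s x) d e := hde
      rcases hde'.of_toggle with h' | ⟨-, h'⟩ | ⟨h', -⟩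
      · exact Subtype.ext h'
      · exact absurd h'.symm he
      · exact absurd h'.symm hd
    · rintro ⟨d⟩
      by_cases hd : D.SameCircle s d (x, 2)
      · exact ⟨⟨Quot.mk _ (x, 0), h⟩, hx.trans (hd.symm.toggle_of_sameCircle hx)⟩
      · exact ⟨⟨Quot.mk _ d, hd⟩, rfl⟩
  have hcard := Nat.card_congr (Equiv.ofBijective f hf)
  have hcompl := Set.ncard_add_ncard_compl {Quot.mk (D.StateStep s) (x, 2)}
  rw [Set.ncard_singleton] at hcompl
  have : ({Quot.mk (D.StateStep s) (x, 2)}ᶜ : Set _).ncard =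
      Nat.card (Quot (D.StateStep (toggle s x))) := hcard
  rw [circleCount_eq, circleCount_eq]
  omega

/-- Switching a crossing whose smoothing arcs lie on the same circle splits this circle. -/
theorem circleCount_toggle_of_sameCircle {χ : D.End → Bool} (hχ : D.IsColoring χ)
    {s : D.State} {x : D.Crossing} (h : D.SameCircle s (x, 0) (x, 2)) :
    D.circleCount (toggle s x) = D.circleCount s + 1 := by
  have h' : ¬ D.SameCircle (toggle s x) (x, 0) (x, 2) := by
    rwa [sameCircle_toggle_iff hχ, not_not]
  have := circleCount_toggle_of_not_sameCircle hχ h'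
  rw [toggle_toggle] at this
  exact this.symm

theorem circleCount_toggle_le {χ : D.End → Bool} (hχ : D.IsColoring χ)
    (s : D.State) (x : D.Crossing) : D.circleCount (toggle s x) ≤ D.circleCount s + 1 := by
  by_cases h : D.SameCircle s (x, 0) (x, 2)
  · exact (circleCount_toggle_of_sameCircle hχ h).le
  · have := circleCount_toggle_of_not_sameCircle hχ h
    omega

/-- The number of B-resolutions of a state. -/
def bCount (s : D.State) : ℕ := (Finset.univ.filter fun x => s x = false).card

theorem bCount_toggle {s : D.State} {x : D.Crossing} (h : s x = true) :
    bCount (toggle s x) = bCount s + 1 := by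
  have : (Finset.univ.filter fun y => toggle s x y = false) =
      insert x (Finset.univ.filter fun y => s y = false) := by
    ext y
    by_cases hy : y = x
    · subst hy; simp [toggle_self, h]
    · simp [toggle_of_ne s hy, hy]
  rw [bCount, this, Finset.card_insert_of_notMem (by simp [h]), bCount]

theorem bCount_toggle_add_one {s : D.State} {x : D.Crossing} (h : s x = false) :
    bCount (toggle s x) + 1 = bCount s := by
  have := bCount_toggle (s := toggle s x) (x := x) (by simp [toggle_self, h])
  rw [toggle_toggle] at this
  exact this.symm

/-- Go from `s₀` to `s` by switching the `k` additional B-crossings one at a time; each switch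
creates at most one circle. -/
theorem circleCount_le_of_le {χ : D.End → Bool} (hχ : D.IsColoring χ) (s₀ : D.State) :
    ∀ (k : ℕ) (s : D.State), bCount s = bCount s₀ + k → (∀ x, s₀ x = false → s x = false) →
      D.circleCount s ≤ D.circleCount s₀ + k := by
  intro k
  induction k with
  | zero =>
    intro s hk hs
    have : (Finset.univ.filter fun x => s₀ x = false) = Finset.univ.filter fun x => s x = false :=
      Finset.eq_of_subset_of_card_le (fun x => by simpa using hs x) hk.le
    have : s = s₀ := by
      funext x
      have h : s₀ x = false ↔ s x = false := by simpa using Finset.ext_iff.1 this x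
      cases h1 : s x <;> cases h2 : s₀ x <;> simp [h1, h2] at h ⊢
    simp [this]
  | succ k ih =>
    intro s hk hs
    obtain ⟨x, hx, hx₀⟩ : ∃ x, s x = false ∧ s₀ x = true := by
      by_contra! hcon
      have : bCount s ≤ bCount s₀ := Finset.card_le_card fun x hx => by
        have := hcon x
        cases h : s₀ x <;> simp_all
      omega
    have h1 := ih (toggle s x) (by have := bCount_toggle_add_one hx; omega) fun y hy => by
      rw [toggle_of_ne s (by rintro rfl; simp_all)]
      exact hs y hy
    have h2 := circleCount_toggle_le hχ (toggle s x) x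
    rw [toggle_toggle] at h2
    omega

theorem bCount_allA : bCount D.allA = 0 := by simp [bCount, allA]

theorem circleCount_le {χ : D.End → Bool} (hχ : D.IsColoring χ) (s : D.State) :
    D.circleCount s ≤ D.circleCount D.allA + bCount s :=
  circleCount_le_of_le hχ D.allA _ s (by simp [bCount_allA]) (by simp [allA])

/-- Starting from the all-A state, switch `x` first. This loses a circle where the general estimate
allows a gain, and the remaining switches cannot recover the deficit of two. -/
theorem circleCount_add_two_le {χ : D.End → Bool} (hχ : D.IsColoring χ) {s : D.State}
    {x : D.Crossing} (hx : s x = false) (hloop : ¬ D.SameCircle D.allA (x, 0) (x, 2)) :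
    D.circleCount s + 2 ≤ D.circleCount D.allA + bCount s := by
  have h1 := circleCount_toggle_of_not_sameCircle hχ hloop
  have h2 : bCount (toggle D.allA x) = 1 := by
    rw [bCount_toggle (by rfl), bCount_allA]
  have h3 : 1 ≤ bCount s := Finset.card_pos.2 ⟨x, by simpa using hx⟩
  have h4 := circleCount_le_of_le hχ (toggle D.allA x) (bCount s - 1) s (by omega) fun y hy => by
    by_cases hyx : y = x
    · rw [hyx, hx]
    · rw [toggle_of_ne _ hyx] at hy
      simp [allA] at hy
  omega

theorem edgeEnds_isDiag_iff (s : D.State) (x : D.Crossing) :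
    (D.edgeEnds s x).IsDiag ↔ D.SameCircle s (x, 0) (x, 2) := by
  rw [edgeEnds, Sym2.mk_isDiag_iff, circleAt, circleAt, Sum.inl.injEq]
  rfl

/-! ### Homology modulo 2 of a plane diagram and the Jordan curve argument. -/

theorem zmod_two_eq_of_add_eq_zero {a b : ZMod 2} (h : a + b = 0) : a = b :=
  CharTwo.add_eq_zero.1 h

/-- The incidence matrix, over the field with two elements, of the crossings and the edges of the
diagram, where an edge is represented by its outgoing end. -/
def incidence (D : Diagram) (o : D.End → Bool) : Matrix D.Crossing {d // o d = true} (ZMod 2) :=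
  Matrix.of fun x d => (if d.1.1 = x then 1 else 0) + if (D.glue d.1).1 = x then 1 else 0

/-- Gluing exchanges outgoing and incoming ends. -/
def outgoingEquiv {o : D.End → Bool} (hglue : ∀ d, o (D.glue d) = !o d) :
    {d // o d = true} ≃ {d // ¬ o d = true} where
  toFun d := ⟨D.glue d.1, by rw [hglue, d.2]; exact Bool.false_ne_true⟩
  invFun d := ⟨D.glue d.1, by have := d.2; rw [hglue]; simpa using this⟩
  left_inv d := Subtype.ext (D.glue_glue d.1)
  right_inv d := Subtype.ext (D.glue_glue d.1)

theorem card_outgoing {o : D.End → Bool} (hglue : ∀ d, o (D.glue d) = !o d) :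
    Fintype.card {d // o d = true} = 2 * Fintype.card D.Crossing := by
  have h1 := Fintype.card_congr (outgoingEquiv hglue)
  have h2 := Fintype.card_subtype_compl fun d => o d = true
  have h3 := Fintype.card_subtype_le fun d => o d = true
  have h4 : Fintype.card D.End = Fintype.card D.Crossing * 4 := by
    rw [Fintype.card_prod, Fintype.card_fin]
  omega

/-- The incidence matrix computes the sum over the ends of a crossing. -/
theorem incidence_mulVec {o : D.End → Bool} (hglue : ∀ d, o (D.glue d) = !o d)
    {φ : D.End → ZMod 2} (hφ : ∀ d, φ (D.glue d) = φ d) (x : D.Crossing) :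
    (D.incidence o).mulVec (fun d => φ d.1) x = ∑ i, φ (x, i) := by
  let g : D.End → ZMod 2 := fun d => if d.1 = x then φ d else 0
  have h1 : (D.incidence o).mulVec (fun d => φ d.1) x =
      ∑ d : {d // o d = true}, (g d.1 + g (D.glue d.1)) := by
    refine Finset.sum_congr rfl fun d _ => ?_
    simp only [incidence, Matrix.of_apply, g, hφ]
    split_ifs <;> ring
  have h2 : ∑ d : {d // o d = true}, g (D.glue d.1) = ∑ d : {d // ¬ o d = true}, g d.1 :=
    Fintype.sum_equiv (outgoingEquiv hglue) _ _ fun d => rfl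
  rw [h1, Finset.sum_add_distrib, h2, Fintype.sum_subtype_add_sum_subtype]
  rw [Fintype.sum_prod_type, Finset.sum_eq_single x]
  · simp [g]
  · intro y _ hy
    simp [g, hy]
  · simp

/-- Each edge has exactly one outgoing end, so identities symmetric under gluing need only be
checked on the columns of the incidence matrix. -/
theorem exists_outgoing {o : D.End → Bool} (hglue : ∀ d, o (D.glue d) = !o d)
    {p : D.End → Prop} (hp : ∀ d, p (D.glue d) → p d)
    (h : ∀ d, o d = true → p d) (d : D.End) : p d := by
  cases hd : o d
  · exact hp d (h _ (by rw [hglue, hd]; rfl))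
  · exact h d hd

/-- A function in this kernel takes equal values at the two crossings of every edge, hence descends
to the connected components. -/
theorem finrank_ker_incidence_transpose
    {o : D.End → Bool} (hglue : ∀ d, o (D.glue d) = !o d) :
    Module.finrank (ZMod 2) (LinearMap.ker (D.incidence o).transpose.mulVecLin) ≤
      D.graphComponentCount := by
  let r : D.Crossing → D.Crossing → Prop := fun x y => ∃ i : Fin 4, y = (D.glue (x, i)).1
  have : Finite (Quot r) := Finite.of_surjective (Quot.mk _) Quot.mk_surjective
  have := Fintype.ofFinite (Quot r)
  have hle : LinearMap.ker (D.incidence o).transpose.mulVecLin ≤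
      LinearMap.range (LinearMap.funLeft (ZMod 2) (ZMod 2) (Quot.mk r)) := by
    intro h hh
    rw [LinearMap.mem_ker, Matrix.mulVecLin_apply] at hh
    have hadd : ∀ d : D.End, h d.1 = h (D.glue d).1 := by
      refine exists_outgoing hglue (fun d hd => by simpa [D.glue_glue] using hd.symm) ?_
      intro d hd
      have := congrFun hh ⟨d, hd⟩
      refine zmod_two_eq_of_add_eq_zero (Eq.trans ?_ this)
      simp [Matrix.mulVec, dotProduct, incidence, add_mul, Finset.sum_add_distrib]
    refine ⟨Quot.lift h ?_, rfl⟩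
    rintro x y ⟨i, rfl⟩
    exact hadd (x, i)
  refine (Submodule.finrank_mono hle).trans ((LinearMap.finrank_range_le _).trans ?_)
  rw [Module.finrank_fintype_fun_eq_card, ← Nat.card_eq_fintype_card]
  rfl

/-- This bounds the dimension of the cycle space: edges minus vertices plus components, with twice
as many edges as vertices. Row rank equals column rank, so the bound on the transposed kernel
suffices. -/
theorem finrank_ker_incidence {o : D.End → Bool} (hglue : ∀ d, o (D.glue d) = !o d) :
    Module.finrank (ZMod 2) (LinearMap.ker (D.incidence o).mulVecLin) ≤
      Fintype.card D.Crossing + D.graphComponentCount := by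
  have h1 := LinearMap.finrank_range_add_finrank_ker (D.incidence o).mulVecLin
  have h2 := LinearMap.finrank_range_add_finrank_ker (D.incidence o).transpose.mulVecLin
  have h3 : Module.finrank (ZMod 2) (LinearMap.range (D.incidence o).transpose.mulVecLin) =
      Module.finrank (ZMod 2) (LinearMap.range (D.incidence o).mulVecLin) :=
    Matrix.rank_transpose _
  have h4 := finrank_ker_incidence_transpose hglue
  rw [Module.finrank_fintype_fun_eq_card] at h1 h2
  have := card_outgoing hglue
  omega

/-- On a plane diagram, every set of edges that meets every crossing in an even number of ends
bounds a set of regions: there is a function on the regions which jumps exactly along these edges.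
(The value of `f` at an end is that on the region following the end in counterclockwise order.) -/
theorem exists_boundary {o : D.End → Bool} (hglue : ∀ d, o (D.glue d) = !o d)
    (hplanar : D.IsPlanar) {ω : D.End → ZMod 2}
    (hω : ∀ d, ω (D.glue d) = ω d) (hsum : ∀ x, ∑ i, ω (x, i) = 0) :
    ∃ f : D.End → ZMod 2, (∀ d, f (D.glue d) = f d + ω d) ∧
      ∀ x i, f (x, i + 1) = f (x, i) + ω (x, i + 1) := by
  let ρ : D.End → D.End := fun d => (d.1, d.2 + 1)
  let r : D.End → D.End → Prop := fun d e => e = ((D.glue d).1, (D.glue d).2 + 1)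
  let rc : D.Crossing → D.Crossing → Prop := fun x y => ∃ i : Fin 4, y = (D.glue (x, i)).1
  have : Finite (Quot r) := Finite.of_surjective (Quot.mk _) Quot.mk_surjective
  have := Fintype.ofFinite (Quot r)
  have : Finite (Quot rc) := Finite.of_surjective (Quot.mk _) Quot.mk_surjective
  have := Fintype.ofFinite (Quot rc)
  have hr : ∀ d, Quot.mk r (ρ (D.glue d)) = Quot.mk r d := fun d => (Quot.sound (r := r) rfl).symm
  have hr' : ∀ d, Quot.mk r (ρ d) = Quot.mk r (D.glue d) := fun d => by
    have := hr (D.glue d)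
    rwa [D.glue_glue] at this
  -- `δ` sends a function on the faces to its jumps across the edges. The claim is that every cycle
  -- is such a jump.
  let δ : (Quot r → ZMod 2) →ₗ[ZMod 2] ({d // o d = true} → ZMod 2) :=
    LinearMap.funLeft (ZMod 2) (ZMod 2) (fun d => Quot.mk r (ρ d.1)) +
      LinearMap.funLeft (ZMod 2) (ZMod 2) (fun d => Quot.mk r d.1)
  have hinv : ∀ (γ : Quot r → ZMod 2) (d : D.End), γ (Quot.mk r (ρ (D.glue d))) +
      γ (Quot.mk r (D.glue d)) = γ (Quot.mk r (ρ d)) + γ (Quot.mk r d) := fun γ d => by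
    rw [hr, hr', add_comm]
  have hrange : LinearMap.range δ ≤ LinearMap.ker (D.incidence o).mulVecLin := by
    rintro _ ⟨γ, rfl⟩
    rw [LinearMap.mem_ker, Matrix.mulVecLin_apply]
    funext x
    refine (incidence_mulVec hglue (φ := fun d => γ (Quot.mk r (ρ d)) + γ (Quot.mk r d))
      (hinv γ) x).trans ?_
    simp only [Finset.sum_add_distrib, Pi.zero_apply, ρ]
    rw [CharTwo.add_eq_zero]
    exact Fintype.sum_equiv (Equiv.addRight 1) _ _ fun i => rfl
  let p : Quot r → Quot rc := Quot.lift (fun d => Quot.mk rc d.1) (by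
    rintro d e rfl
    exact Quot.sound ⟨d.2, rfl⟩)
  have hker : LinearMap.ker δ ≤ LinearMap.range (LinearMap.funLeft (ZMod 2) (ZMod 2) p) := by
    intro γ hγ
    rw [LinearMap.mem_ker] at hγ
    have hrot : ∀ d, γ (Quot.mk r (ρ d)) + γ (Quot.mk r d) = 0 :=
      exists_outgoing hglue (fun d hd => by rwa [hinv] at hd) fun d hd => congrFun hγ ⟨d, hd⟩
    have hstep : ∀ x i, γ (Quot.mk r (x, i + 1)) = γ (Quot.mk r (x, i)) := fun x i =>
      zmod_two_eq_of_add_eq_zero (hrot (x, i))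
    have hzero : ∀ x i, γ (Quot.mk r (x, i)) = γ (Quot.mk r (x, 0)) := by
      intro x i
      have h0 := hstep x 0
      have h1 := hstep x 1
      have h2 := hstep x 2
      fin_cases i
      · rfl
      · exact h0
      · exact h1.trans h0
      · exact h2.trans (h1.trans h0)
    refine ⟨Quot.lift (fun x => γ (Quot.mk r (x, 0))) ?_, ?_⟩
    · rintro x y ⟨i, rfl⟩
      rw [← hzero x i, ← hr (x, i), ← hzero _ ((D.glue (x, i)).2 + 1)]
    · funext c
      obtain ⟨⟨x, i⟩, rfl⟩ := Quot.exists_rep c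
      exact (hzero x i).symm
  have hkerle : Module.finrank (ZMod 2) (LinearMap.ker δ) ≤ D.graphComponentCount := by
    refine (Submodule.finrank_mono hker).trans ((LinearMap.finrank_range_le _).trans ?_)
    rw [Module.finrank_fintype_fun_eq_card, ← Nat.card_eq_fintype_card]
    rfl
  -- Dimension count: the range has dimension at least faces minus components. By Euler's formula
  -- this equals vertices plus components, the bound for the cycle space.
  have heq : LinearMap.range δ = LinearMap.ker (D.incidence o).mulVecLin := by
    refine Submodule.eq_of_le_of_finrank_le hrange ((finrank_ker_incidence hglue).trans ?_)
    have h1 := LinearMap.finrank_range_add_finrank_ker δ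
    rw [Module.finrank_fintype_fun_eq_card, ← Nat.card_eq_fintype_card] at h1
    have h2 : Nat.card (Quot r) = D.faceCount := rfl
    have h3 := hplanar
    simp only [IsPlanar] at h3
    omega
  have hmem : (fun d : {d // o d = true} => ω d.1) ∈ LinearMap.range δ := by
    rw [heq, LinearMap.mem_ker, Matrix.mulVecLin_apply]
    funext x
    exact (incidence_mulVec hglue hω x).trans (hsum x)
  obtain ⟨γ, hγ⟩ := hmem
  have hall : ∀ d, γ (Quot.mk r (ρ d)) + γ (Quot.mk r d) = ω d :=
    exists_outgoing hglue (fun d hd => by rwa [hinv, hω] at hd) fun d hd => congrFun hγ ⟨d, hd⟩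
  refine ⟨fun d => γ (Quot.mk r (ρ d)), fun d => ?_, fun x i => ?_⟩
  · have h := hall d
    simp only [hr]
    rw [← h, ← add_assoc, CharTwo.add_self_eq_zero, zero_add]
  · rw [← hall (x, i + 1)]
    exact (by decide : ∀ a b : ZMod 2, a = b + (a + b)) _ _

/-- A plane diagram has a checkerboard colouring. -/
theorem exists_isColoring {o : D.End → Bool} (hglue : ∀ d, o (D.glue d) = !o d)
    (hplanar : D.IsPlanar) : ∃ χ, D.IsColoring χ := by
  obtain ⟨f, hf1, hf2⟩ := exists_boundary hglue hplanar (ω := fun _ => 1) (fun _ => rfl) fun x => by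
    simp
    decide
  have h : ∀ a : ZMod 2, decide (a + 1 = 0) = !decide (a = 0) := by decide
  refine ⟨fun d => decide (f d = 0), fun x i => ?_, fun d => ?_⟩
  · simp only [hf2, h]
  · simp only [hf1, h]

/-- Jordan curve argument: on a plane diagram, two different state circles cannot be joined by
two crossings that lie in regions of opposite colours. -/
theorem not_joined_twice {o : D.End → Bool} (hglue : ∀ d, o (D.glue d) = !o d)
    (hplanar : D.IsPlanar) {χ : D.End → Bool} (hχ : D.IsColoring χ) {t : D.State}
    {x y : D.Crossing} (hx : t x = true) (hy : t y = false) (hxy : χ (x, 0) = χ (y, 0))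
    (hne : ¬ D.SameCircle t (y, 0) (y, 2)) :
    ¬ ((D.SameCircle t (y, 0) (x, 0) ∧ D.SameCircle t (y, 2) (x, 2)) ∨
      (D.SameCircle t (y, 2) (x, 0) ∧ D.SameCircle t (y, 0) (x, 2))) := by
  classical
  -- The cycle is the state circle through `(y, 0)`; the function `f` obtained from it separates its
  -- two sides.
  let ω : D.End → ZMod 2 := fun d => if D.SameCircle t (y, 0) d then 1 else 0
  have hωc : ∀ {d e}, D.SameCircle t d e → ω e = ω d := fun {d e} h => by
    have : D.SameCircle t (y, 0) e ↔ D.SameCircle t (y, 0) d := ⟨(·.trans h.symm), (·.trans h)⟩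
    simp only [ω, this]
  obtain ⟨f, hf1, hf2⟩ := exists_boundary hglue hplanar (ω := ω)
    (fun d => hωc (sameCircle_glue t d)) fun z => by
      rw [Fin.sum_univ_four]
      cases hz : t z
      · rw [hωc (sameCircle_zero_three hz), hωc (sameCircle_one_two hz)]
        generalize ω (z, 0) = a
        generalize ω (z, 1) = b
        revert a b
        decide
      · rw [hωc (sameCircle_zero_one hz), hωc (sameCircle_two_three hz)]
        generalize ω (z, 0) = a
        generalize ω (z, 2) = b
        revert a b
        decide
  -- `u` is the value of `f` on the region of colour `false` beside the end. Unlike `f`, it is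
  -- constant along each state circle.
  let u : D.End → ZMod 2 := fun d => f d + if χ d then ω d else 0
  have hu1 : ∀ d, u (D.glue d) = u d := fun d => by
    simp only [u, hf1, hχ.2, hωc (sameCircle_glue t d)]
    generalize f d = a
    generalize ω d = b
    generalize χ d = c
    revert a b c
    decide
  have hu2 : ∀ z i, ω (z, i + 1) = ω (z, i) → u (z, i + 1) = u (z, i) := fun z i h => by
    simp only [u, hf2, hχ.1, h]
    generalize f (z, i) = a
    generalize ω (z, i) = b
    generalize χ (z, i) = c
    revert a b c
    decide
  have hu : ∀ {d e}, D.SameCircle t d e → u d = u e := by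
    intro d e h
    refine h.map_eq hu1 ?_
    rintro ⟨z, i⟩
    cases hz : t z
    · have h1 := hu2 z 1 (hωc (sameCircle_one_two hz))
      have h2 := hu2 z 3 (hωc (sameCircle_zero_three hz).symm)
      fin_cases i <;> simp only [smooth, hz, smoothEnd]
      exacts [h2.symm, h1, h1.symm, h2]
    · have h1 := hu2 z 0 (hωc (sameCircle_zero_one hz))
      have h2 := hu2 z 2 (hωc (sameCircle_two_three hz))
      fin_cases i <;> simp only [smooth, hz, smoothEnd]
      exacts [h1, h1.symm, h2, h2.symm]
  have hx1 : f (x, 2) = f (x, 0) + ω (x, 0) + ω (x, 2) := by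
    rw [← hωc (sameCircle_zero_one hx)]
    exact (hf2 x 1).trans (congrArg (· + _) (hf2 x 0))
  have hy1 : f (y, 2) = f (y, 0) + ω (y, 2) + ω (y, 2) := by
    have h : ω (y, 2) = ω (y, 1) := hωc (sameCircle_one_two hy)
    calc f (y, 2) = f (y, 0) + ω (y, 1) + ω (y, 2) :=
          (hf2 y 1).trans (congrArg (· + _) (hf2 y 0))
      _ = _ := by rw [← h]
  have hω0 : ω (y, 0) = 1 := if_pos rfl
  have hω2 : ω (y, 2) = 0 := if_neg hne
  have hχx := hχ.apply_two x
  have hχy := hχ.apply_two y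
  -- Exactly one of the ends 0 and 2 lies on the chosen circle, both at `x` and at `y`. So `f`
  -- changes between these ends at the A-crossing `x` but not at the B-crossing `y`, whereas `u` and
  -- the colours agree.
  rintro (⟨h0, h2⟩ | ⟨h0, h2⟩)
  · have e0 := hu h0
    have e2 := hu h2
    have w0 := hωc h0
    have w2 := hωc h2
    simp only [u, hχx, hχy, hxy, hx1, hy1, w0, w2, hω0, hω2] at e0 e2
    simp at e0 e2
    simp [e0] at e2
  · have e0 := hu h0
    have e2 := hu h2
    have w0 := hωc h0
    have w2 := hωc h2
    simp only [u, hχx, hχy, hxy, hx1, hy1, w0, w2, hω0, hω2] at e0 e2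
    simp at e0 e2
    simp [e0] at e2

/-- On a plane diagram, one-edge loops of the all-A state graph that lie in regions of the same
colour do not interfere with each other. -/
theorem sameCircle_of_loops {o : D.End → Bool} (hglue : ∀ d, o (D.glue d) = !o d)
    (hplanar : D.IsPlanar) {χ : D.End → Bool} (hχ : D.IsColoring χ) (c : Bool) :
    ∀ (k : ℕ) (t : D.State), bCount t = k →
      (∀ y, t y = false → χ (y, 0) = c ∧ D.SameCircle D.allA (y, 0) (y, 2)) →
      ∀ x, t x = true → χ (x, 0) = c → D.SameCircle D.allA (x, 0) (x, 2) →
        D.SameCircle t (x, 0) (x, 2) := by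
  intro k
  induction k with
  | zero =>
    intro t hk _ x _ _ hloop
    have : t = D.allA := by
      funext y
      have := Finset.ext_iff.1 (Finset.card_eq_zero.1 hk) y
      simpa [allA] using this
    rwa [this]
  | succ k ih =>
    intro t hk ht x hx hxc hloop
    obtain ⟨y, hy⟩ : ∃ y, t y = false := by
      obtain ⟨y, hy⟩ := Finset.card_pos.1 (show 0 < bCount t by omega)
      exact ⟨y, by simpa using hy⟩
    have hxy : x ≠ y := by rintro rfl; simp_all
    have hIH := ih (toggle t y) (by have := bCount_toggle_add_one hy; omega) fun z hz => ht z (by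
      rwa [toggle_of_ne t (by rintro rfl; simp [toggle_self, hy] at hz)] at hz)
    have hy' := hIH y (by simp [toggle_self, hy]) (ht y hy).1 (ht y hy).2
    have hx' := hIH x (by rwa [toggle_of_ne t hxy]) hxc hloop
    -- With `y` switched back, both `x` and `y` are loops by induction. Switching `y` splits a
    -- circle, and `x` could only cease to be a loop by joining the two pieces, which is the
    -- excluded configuration.
    rw [sameCircle_toggle_iff hχ] at hy'
    refine hx'.of_toggle.resolve_right fun h => ?_
    exact not_joined_twice hglue hplanar hχ hx hy (hxc.trans (ht y hy).1.symm) hy' h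

end Diagram

end LinkDiag

/-! ### The all-A state of a cable: parallel copies of the state circles. -/

namespace LinkDiag

theorem gridCoord_add_one (m : ℕ) (k : Fin 4) (c : Fin m × Fin m) :
    gridCoord m (k + 1) c = ((gridCoord m k c).2, (gridCoord m k c).1.rev) := by
  fin_cases k <;> simp [gridCoord]

namespace Diagram

variable {D : Diagram} {m : ℕ}

/-- The crossing of the `m`-cable in a given cell of the grid at `x`. -/
def cell (x : D.Crossing) (c : Fin m × Fin m) : (D.cable m).Crossing := (x, c)

theorem exists_cell (z : (D.cable m).Crossing) : ∃ (x : D.Crossing) (p q : Fin m),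
    z = cell x (p, q) := ⟨z.1, z.2.1, z.2.2, rfl⟩

/-- The end at which the `i`-th strand leaves the grid of the `m`-cable through the end `d`. -/
def boundaryEnd (m : ℕ) (d : D.End) (i : Fin m) : (D.cable m).End :=
  (cell d.1 (gridCell m d.2 (i, ⟨0, i.pos⟩)), d.2)

theorem cable_glue_boundaryEnd (d : D.End) (i : Fin m) :
    (D.cable m).glue (boundaryEnd m d i) = boundaryEnd m (D.glue d) i.rev := by
  change D.cableGlue m ((d.1, gridCell m d.2 (i, ⟨0, i.pos⟩)), d.2) =
    (((D.glue d).1, gridCell m (D.glue d).2 (i.rev, ⟨0, i.rev.pos⟩)), (D.glue d).2)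
  simp [cableGlue, gridCoord_gridCell]

theorem cable_glue_gridCell (x : D.Crossing) (k : Fin 4) (i : Fin m) (j : ℕ) (hj : j + 1 < m) :
    (D.cable m).glue (cell x (gridCell m k (i, ⟨j + 1, hj⟩)), k) =
      (cell x (gridCell m k (i, ⟨j, by omega⟩)), k + 2) := by
  change D.cableGlue m ((x, gridCell m k (i, ⟨j + 1, hj⟩)), k) =
    ((x, gridCell m k (i, ⟨j, by omega⟩)), k + 2)
  simp [cableGlue, gridCoord_gridCell]

theorem cable_glue_west (x : D.Crossing) (p : ℕ) (hp : p + 1 < m) (q : Fin m) :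
    (D.cable m).glue (cell x (⟨p + 1, hp⟩, q), 3) = (cell x (⟨p, by omega⟩, q), 1) := by
  simpa [gridCell] using cable_glue_gridCell x 3 q.rev p hp

theorem cable_glue_south (x : D.Crossing) (p : Fin m) (q : ℕ) (hq : q + 1 < m) :
    (D.cable m).glue (cell x (p, ⟨q + 1, hq⟩), 0) = (cell x (p, ⟨q, by omega⟩), 2) := by
  simpa [gridCell] using cable_glue_gridCell x 0 p q hq

theorem cable_glue_east (x : D.Crossing) (p : ℕ) (hp : p + 1 < m) (q : Fin m) :
    (D.cable m).glue (cell x (⟨p, by omega⟩, q), 1) = (cell x (⟨p + 1, hp⟩, q), 3) := by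
  rw [← cable_glue_west, (D.cable m).glue_glue]

theorem cable_glue_north (x : D.Crossing) (p : Fin m) (q : ℕ) (hq : q + 1 < m) :
    (D.cable m).glue (cell x (p, ⟨q, by omega⟩), 2) = (cell x (p, ⟨q + 1, hq⟩), 0) := by
  rw [← cable_glue_south, (D.cable m).glue_glue]

theorem boundaryEnd_zero (x : D.Crossing) (i : Fin m) :
    boundaryEnd m (x, 0) i = (cell x (i, ⟨0, i.pos⟩), 0) := rfl

theorem boundaryEnd_one (x : D.Crossing) (i : Fin m) :
    boundaryEnd m (x, 1) i = (cell x (⟨m - 1, by have := i.pos; omega⟩, i), 1) := rfl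

theorem boundaryEnd_two (x : D.Crossing) (i : Fin m) :
    boundaryEnd m (x, 2) i = (cell x (i.rev, ⟨m - 1, by have := i.pos; omega⟩), 2) := rfl

theorem boundaryEnd_three (x : D.Crossing) (i : Fin m) :
    boundaryEnd m (x, 3) i = (cell x (⟨0, i.pos⟩, i.rev), 3) := rfl

/-- To compare two functions on the ends of the cable before and after gluing, it suffices to
consider the edges leaving the grids and the horizontal and vertical edges inside. -/
theorem cable_glue_induction {r : (D.cable m).End → (D.cable m).End → Prop}
    (hsymm : ∀ z w, r z w → r w z)
    (hb : ∀ d i, r (boundaryEnd m d i) (boundaryEnd m (D.glue d) i.rev))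
    (heast : ∀ x p (hp : p + 1 < m) q,
      r (cell x (⟨p, by omega⟩, q), 1) (cell x (⟨p + 1, hp⟩, q), 3))
    (hnorth : ∀ x p q (hq : q + 1 < m),
      r (cell x (p, ⟨q, by omega⟩), 2) (cell x (p, ⟨q + 1, hq⟩), 0))
    (z : (D.cable m).End) : r z ((D.cable m).glue z) := by
  have hb' : ∀ d i, r (boundaryEnd m d i) ((D.cable m).glue (boundaryEnd m d i)) := fun d i => by
    rw [cable_glue_boundaryEnd]
    exact hb d i
  obtain ⟨y, k⟩ := z
  obtain ⟨x, ⟨p, hp⟩, ⟨q, hq⟩, rfl⟩ := exists_cell y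
  fin_cases k
  · rcases q with _ | q
    · exact hb' (x, 0) ⟨p, hp⟩
    · have := cable_glue_south x ⟨p, hp⟩ q hq
      exact (congrArg (r _) this).mpr (hsymm _ _ (hnorth _ _ _ _))
  · by_cases h : p + 1 < m
    · have := cable_glue_east x p h ⟨q, hq⟩
      exact (congrArg (r _) this).mpr (heast _ _ _ _)
    · obtain rfl : p = m - 1 := by omega
      exact hb' (x, 1) ⟨q, hq⟩
  · by_cases h : q + 1 < m
    · have := cable_glue_north x ⟨p, hp⟩ q h
      exact (congrArg (r _) this).mpr (hnorth _ _ _ _)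
    · obtain rfl : q = m - 1 := by omega
      have := hb' (x, 2) (Fin.rev ⟨p, hp⟩)
      rw [boundaryEnd_two, Fin.rev_rev] at this
      exact this
  · rcases p with _ | p
    · have := hb' (x, 3) (Fin.rev ⟨q, hq⟩)
      rw [boundaryEnd_three, Fin.rev_rev] at this
      exact this
    · have := cable_glue_west x p hp ⟨q, hq⟩
      exact (congrArg (r _) this).mpr (hsymm _ _ (heast _ _ _ _))

/-- The checkerboard colouring of a cable. -/
def cableColoring (m : ℕ) (χ : D.End → Bool) (z : (D.cable m).End) : Bool :=
  decide (((if χ (z.1.1, z.2) then m else 0) + (gridCoord m z.2 z.1.2).1 +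
    (gridCoord m z.2 z.1.2).2) % 2 = 1)

theorem decide_odd_eq_not {a b : ℕ} (h : (a + b) % 2 = 1) :
    decide (a % 2 = 1) = !decide (b % 2 = 1) := by
  rw [← decide_not, decide_eq_decide]
  omega

/-- A quarter turn replaces `(i, j)` by `(j, m - 1 - i)`, changing the parity of the sum by `m - 1`.
The summand `m`, switched on and off by `χ`, makes the total change odd; the same correction works
where strands are renumbered along an edge. -/
theorem IsColoring.cable {χ : D.End → Bool} (hχ : D.IsColoring χ) (m : ℕ) :
    (D.cable m).IsColoring (cableColoring m χ) := by
  refine ⟨fun z k => decide_odd_eq_not ?_, fun z => ?_⟩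
  · simp only [gridCoord_add_one, hχ.1]
    have := (gridCoord m k z.2).1.2
    cases χ (z.1, k) <;> simp [Fin.val_rev] <;> omega
  refine cable_glue_induction (r := fun z w => cableColoring m χ w = !cableColoring m χ z)
    (fun z w h => by rw [h, Bool.not_not]) ?_ ?_ ?_ z
  · intro d i
    refine decide_odd_eq_not ?_
    simp only [boundaryEnd, cell, gridCoord_gridCell, Prod.mk.eta, hχ.2]
    have := i.2
    cases χ d <;> simp [Fin.val_rev] <;> omega
  · intro x p hp q
    refine decide_odd_eq_not ?_
    simp only [cell, gridCoord, hχ.apply_one, hχ.apply_three]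
    cases χ (x, 0) <;> simp [Fin.val_rev] <;> omega
  · intro x p q hq
    refine decide_odd_eq_not ?_
    simp only [cell, gridCoord, hχ.apply_two, Fin.val_rev]
    by_cases hc : χ (x, 0) = true <;> simp [hc] <;> omega

section Walk

variable {s : (D.cable m).State} {x : D.Crossing}

theorem sameCircle_boundaryEnd (s : (D.cable m).State) (d : D.End) (i : Fin m) :
    (D.cable m).SameCircle s (boundaryEnd m d i) (boundaryEnd m (D.glue d) i.rev) := by
  rw [← cable_glue_boundaryEnd]
  exact sameCircle_glue _ _

theorem sameCircle_east (s : (D.cable m).State) (x : D.Crossing) (p : ℕ) (hp : p + 1 < m)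
    (q : Fin m) :
    (D.cable m).SameCircle s (cell x (⟨p, by omega⟩, q), 1) (cell x (⟨p + 1, hp⟩, q), 3) := by
  rw [← cable_glue_east]
  exact sameCircle_glue _ _

theorem sameCircle_north (s : (D.cable m).State) (x : D.Crossing) (p : Fin m) (q : ℕ)
    (hq : q + 1 < m) :
    (D.cable m).SameCircle s (cell x (p, ⟨q, by omega⟩), 2) (cell x (p, ⟨q + 1, hq⟩), 0) := by
  rw [← cable_glue_north]
  exact sameCircle_glue _ _

/-- One step of a staircase: the strand leaves to the east, turns north in the next cell, and
arrives from the south. Only the intermediate cell must carry an A-resolution. -/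
theorem sameCircle_diagonal_one {p q : ℕ} (hp : p + 1 < m) (hq : q + 1 < m)
    (h : s (cell x (⟨p + 1, hp⟩, ⟨q, by omega⟩)) = true) :
    (D.cable m).SameCircle s (cell x (⟨p, by omega⟩, ⟨q, by omega⟩), 1)
      (cell x (⟨p + 1, hp⟩, ⟨q + 1, hq⟩), 0) :=
  (sameCircle_east s x p hp _).trans
    ((sameCircle_two_three h).symm.trans (sameCircle_north s x _ q hq))

theorem sameCircle_diagonal_two {p q : ℕ} (hp : p + 1 < m) (hq : q + 1 < m)
    (h : s (cell x (⟨p, by omega⟩, ⟨q + 1, hq⟩)) = true) :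
    (D.cable m).SameCircle s (cell x (⟨p, by omega⟩, ⟨q, by omega⟩), 2)
      (cell x (⟨p + 1, hp⟩, ⟨q + 1, hq⟩), 3) :=
  (sameCircle_north s x _ q hq).trans
    ((sameCircle_zero_one h).trans (sameCircle_east s x p hp _))

end Walk

/-- Follow the staircase towards the south-west. The difference `p - q` is constant along it and is
the number of the strand at the south side. -/
theorem sameCircle_boundaryEnd_zero (x : D.Crossing) (q : ℕ) : ∀ (p : ℕ) (hp : p < m)
    (hqp : q ≤ p), (D.cable m).SameCircle (D.cable m).allA
      (cell x (⟨p, hp⟩, ⟨q, by omega⟩), 0) (boundaryEnd m (x, 0) ⟨p - q, by omega⟩) := by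
  induction q with
  | zero => intro p hp _; rfl
  | succ q ih =>
    intro p hp hqp
    obtain ⟨p, rfl⟩ : ∃ p', p = p' + 1 := ⟨p - 1, by omega⟩
    have h := ih p (by omega) (by omega)
    simp only [Nat.add_sub_add_right]
    exact (sameCircle_diagonal_one hp (by omega) rfl).symm.trans
      ((sameCircle_zero_one rfl).symm.trans h)

/-- The staircase towards the north-east; `k` counts the rows still above the cell. -/
theorem sameCircle_boundaryEnd_two (x : D.Crossing) (k : ℕ) : ∀ (p q : ℕ) (hq : q < m)
    (hpq : p ≤ q), q + k + 1 = m → (D.cable m).SameCircle (D.cable m).allA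
      (cell x (⟨p, by omega⟩, ⟨q, hq⟩), 2) (boundaryEnd m (x, 2) ⟨q - p, by omega⟩) := by
  induction k with
  | zero =>
    intro p q hq hpq hm
    rw [boundaryEnd_two]
    have h1 : (⟨p, by omega⟩ : Fin m) = Fin.rev ⟨q - p, by omega⟩ := by
      ext
      simp [Fin.val_rev]
      omega
    have h2 : (⟨q, hq⟩ : Fin m) = ⟨m - 1, by omega⟩ := by
      ext
      simp
      omega
    rw [h1, h2]
    rfl
  | succ k ih =>
    intro p q hq hpq hm
    have h := ih (p + 1) (q + 1) (by omega) (by omega) (by omega)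
    simp only [Nat.add_sub_add_right] at h
    exact (sameCircle_diagonal_two (by omega) (by omega) rfl).trans
      ((sameCircle_two_three rfl).symm.trans h)

/-- The end and the number of the strand through which the smoothing arc at an end of the cable
leaves the grid in the all-A state: arcs below the diagonal run parallel to the arc that joins the
ends 0 and 1, the others run parallel to the arc that joins the ends 2 and 3. -/
def outerStrand (z : (D.cable m).End) : D.End × Fin m :=
  if z.2.val < 2 then
    if (z.1.2.2 : ℕ) ≤ z.1.2.1 then ((z.1.1, 0), ⟨z.1.2.1 - z.1.2.2, by omega⟩)
    else ((z.1.1, 2), ⟨z.1.2.2 - z.1.2.1 - 1, by omega⟩)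
  else
    if (z.1.2.1 : ℕ) ≤ z.1.2.2 then ((z.1.1, 2), ⟨z.1.2.2 - z.1.2.1, by omega⟩)
    else ((z.1.1, 0), ⟨z.1.2.1 - z.1.2.2 - 1, by omega⟩)

theorem outerStrand_low (x : D.Crossing) (p q : Fin m) {k : Fin 4} (hk : k.val < 2) :
    outerStrand (D := D) (cell x (p, q), k) =
      if (q : ℕ) ≤ p then ((x, 0), ⟨p - q, by omega⟩) else ((x, 2), ⟨q - p - 1, by omega⟩) :=
  if_pos hk

theorem outerStrand_high (x : D.Crossing) (p q : Fin m) {k : Fin 4} (hk : ¬ k.val < 2) :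
    outerStrand (D := D) (cell x (p, q), k) =
      if (p : ℕ) ≤ q then ((x, 2), ⟨q - p, by omega⟩) else ((x, 0), ⟨p - q - 1, by omega⟩) :=
  if_neg hk

theorem sameCircle_outerStrand (z : (D.cable m).End) : (D.cable m).SameCircle (D.cable m).allA z
    (boundaryEnd m (outerStrand z).1 (outerStrand z).2) := by
  obtain ⟨y, k⟩ := z
  obtain ⟨x, ⟨p, hp⟩, ⟨q, hq⟩, rfl⟩ := exists_cell y
  have hlow : (D.cable m).SameCircle (D.cable m).allA (cell x (⟨p, hp⟩, ⟨q, hq⟩), 0)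
      (boundaryEnd m (outerStrand (D := D) (cell x (⟨p, hp⟩, ⟨q, hq⟩), 0)).1
        (outerStrand (D := D) (cell x (⟨p, hp⟩, ⟨q, hq⟩), 0)).2) := by
    rw [outerStrand_low x _ _ (by decide)]
    split_ifs with h
    · exact sameCircle_boundaryEnd_zero x q p hp h
    · simp only [not_le] at h
      obtain ⟨q, rfl⟩ : ∃ q', q = q' + 1 := ⟨q - 1, by omega⟩
      have h1 := sameCircle_boundaryEnd_two (m := m) x (m - 1 - q) p q (by omega) (by omega) (by omega)
      have h2 : q + 1 - p - 1 = q - p := by omega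
      simp only [h2]
      exact (sameCircle_north _ x _ q hq).symm.trans h1
  have hhigh : (D.cable m).SameCircle (D.cable m).allA (cell x (⟨p, hp⟩, ⟨q, hq⟩), 2)
      (boundaryEnd m (outerStrand (D := D) (cell x (⟨p, hp⟩, ⟨q, hq⟩), 2)).1
        (outerStrand (D := D) (cell x (⟨p, hp⟩, ⟨q, hq⟩), 2)).2) := by
    rw [outerStrand_high x _ _ (by decide)]
    split_ifs with h
    · exact sameCircle_boundaryEnd_two (m := m) x (m - 1 - q) p q hq h (by omega)
    · simp only [not_le] at h
      obtain ⟨p, rfl⟩ : ∃ p', p = p' + 1 := ⟨p - 1, by omega⟩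
      have h1 := sameCircle_boundaryEnd_zero (m := m) x q p (by omega) (by omega)
      have h2 : p + 1 - q - 1 = p - q := by omega
      simp only [h2]
      exact (sameCircle_two_three rfl).trans ((sameCircle_east _ x p hp _).symm.trans
        ((sameCircle_zero_one rfl).symm.trans h1))
  fin_cases k
  · exact hlow
  · exact (sameCircle_zero_one rfl).symm.trans hlow
  · exact hhigh
  · exact (sameCircle_two_three rfl).symm.trans hhigh

/-- The level, counted from the regions of colour `false`, of the `i`-th strand at an end of colour
`b`. Conversely, the strand on a given level. -/
def level (b : Bool) (i : Fin m) : Fin m := if b then i.rev else i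

theorem level_level (b : Bool) (i : Fin m) : level b (level b i) = i := by
  cases b <;> simp [level]

theorem level_not (b : Bool) (i : Fin m) : level (!b) i = (level b i).rev := by
  cases b <;> simp [level]

theorem level_not_rev (b : Bool) (i : Fin m) : level (!b) i.rev = level b i := by
  cases b <;> simp [level]

/-- In the all-A state of a cable, the state circle through an end is given by a state circle of
the diagram and a level. -/
def cableLabel (χ : D.End → Bool) (z : (D.cable m).End) : Quot (D.StateStep D.allA) × Fin m :=
  (Quot.mk _ (outerStrand z).1, level (χ (outerStrand z).1) (outerStrand z).2)

theorem cableLabel_boundaryEnd {χ : D.End → Bool} (hχ : D.IsColoring χ) (d : D.End) (i : Fin m) :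
    cableLabel χ (boundaryEnd m d i) = (Quot.mk _ d, level (χ d) i) := by
  obtain ⟨x, k⟩ := d
  have h01 : Quot.mk (D.StateStep D.allA) (x, 0) = Quot.mk _ (x, 1) := sameCircle_zero_one rfl
  have h23 : Quot.mk (D.StateStep D.allA) (x, 2) = Quot.mk _ (x, 3) := sameCircle_two_three rfl
  fin_cases k
  · have h : outerStrand (boundaryEnd m (x, 0) i) = ((x, 0), i) := by
      rw [boundaryEnd_zero, outerStrand_low x _ _ (by decide)]
      simp
    simp [cableLabel, h]
  · have h : outerStrand (boundaryEnd m (x, 1) i) = ((x, 0), i.rev) := by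
      rw [boundaryEnd_one, outerStrand_low x _ _ (by decide), if_pos (by simp; omega)]
      refine Prod.ext rfl (Fin.ext ?_)
      simp [Fin.val_rev]
      omega
    simp [cableLabel, h, h01, hχ.apply_one, ← level_not_rev (χ (x, 0))]
  · have h : outerStrand (boundaryEnd m (x, 2) i) = ((x, 2), i) := by
      rw [boundaryEnd_two, outerStrand_high x _ _ (by decide),
        if_pos (by simp [Fin.val_rev]; omega)]
      refine Prod.ext rfl (Fin.ext ?_)
      simp [Fin.val_rev]
      omega
    simp [cableLabel, h]
  · have h : outerStrand (boundaryEnd m (x, 3) i) = ((x, 2), i.rev) := by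
      rw [boundaryEnd_three, outerStrand_high x _ _ (by decide), if_pos (by simp)]
      refine Prod.ext rfl (Fin.ext ?_)
      simp
    simp [cableLabel, h, h23, hχ.apply_two, hχ.apply_three, ← level_not_rev (χ (x, 0))]

/-- Along an edge of the diagram the strand numbers are reversed and the colour changes, so the
level is preserved. Inside a grid, the two ends joined by an edge or a smoothing arc already have
the same `outerStrand`. -/
theorem cableLabel_eq {χ : D.End → Bool} (hχ : D.IsColoring χ) {z w : (D.cable m).End}
    (h : (D.cable m).SameCircle (D.cable m).allA z w) : cableLabel χ z = cableLabel χ w := by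
  refine h.map_eq ?_ ?_
  · refine fun z => (cable_glue_induction (r := fun z w => cableLabel χ z = cableLabel χ w)
      (fun _ _ h => h.symm) ?_ ?_ ?_ z).symm
    · intro d i
      rw [cableLabel_boundaryEnd hχ, cableLabel_boundaryEnd hχ, hχ.2, level_not_rev]
      exact Prod.ext (sameCircle_glue _ d) rfl
    · intro x p hp q
      refine congrArg (fun a : D.End × Fin m => (Quot.mk (D.StateStep D.allA) a.1,
        level (χ a.1) a.2)) ?_
      rw [outerStrand_low x _ _ (by decide), outerStrand_high x _ _ (by decide)]
      by_cases hqp : (q : ℕ) ≤ p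
      · rw [if_pos hqp, if_neg (by simp; omega)]
        simp
        omega
      · rw [if_neg hqp, if_pos (by simp; omega)]
        simp
        omega
    · intro x p q hq
      refine congrArg (fun a : D.End × Fin m => (Quot.mk (D.StateStep D.allA) a.1,
        level (χ a.1) a.2)) ?_
      rw [outerStrand_low x _ _ (k := 0) (by decide), outerStrand_high x _ _ (k := 2) (by decide)]
      by_cases hqp : (p : ℕ) ≤ q
      · rw [if_pos (by simp; omega), if_neg (by simp; omega)]
        simp
        omega
      · rw [if_neg (by simp; omega), if_pos (by simp; omega)]
        simp
        omega
  · rintro ⟨y, k⟩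
    obtain ⟨x, p, q, rfl⟩ := exists_cell y
    refine congrArg (fun a : D.End × Fin m => (Quot.mk (D.StateStep D.allA) a.1,
      level (χ a.1) a.2)) ?_
    fin_cases k <;> rfl

end Diagram

end LinkDiag

/-! ### Loops of the all-A state graph of a cable. -/

namespace LinkDiag

namespace Diagram

variable {D : Diagram} {m : ℕ}

/-- The circles of the all-A state of a cable are parallel copies of those of the diagram. -/
def cableCircleEquiv {χ : D.End → Bool} (hχ : D.IsColoring χ) (m : ℕ) :
    Quot ((D.cable m).StateStep (D.cable m).allA) ≃ Quot (D.StateStep D.allA) × Fin m where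
  toFun := Quot.lift (cableLabel χ) fun _ _ h => cableLabel_eq hχ (Quot.sound h)
  invFun c := Quot.lift (fun d => Quot.mk _ (boundaryEnd m d (level (χ d) c.2))) (by
    rintro d e (rfl | rfl)
    · rw [hχ.2, level_not]
      exact sameCircle_boundaryEnd _ _ _
    · obtain ⟨x, k⟩ := d
      have h1 : ∀ i, (D.cable m).SameCircle (D.cable m).allA (boundaryEnd m (x, 0) i)
          (boundaryEnd m (x, 1) i.rev) := fun i => by
        have h := sameCircle_outerStrand (D := D) (boundaryEnd m (x, 1) i.rev)
        rw [boundaryEnd_one, outerStrand_low x _ _ (by decide), if_pos (by simp; omega)] at h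
        rw [boundaryEnd_one]
        convert h.symm using 2
        ext
        simp [Fin.val_rev]
        omega
      have h2 : ∀ i, (D.cable m).SameCircle (D.cable m).allA (boundaryEnd m (x, 2) i)
          (boundaryEnd m (x, 3) i.rev) := fun i => by
        have h := sameCircle_outerStrand (D := D) (boundaryEnd m (x, 3) i.rev)
        rw [boundaryEnd_three, outerStrand_high x _ _ (by decide), if_pos (by simp)] at h
        rw [boundaryEnd_three]
        convert h.symm using 2
        ext
        simp
      fin_cases k
      · simpa [SameCircle, smoothEnd, allA, hχ.apply_one, level_not] using h1 (level (χ (x, 0)) c.2)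
      · simpa [SameCircle, smoothEnd, allA, hχ.apply_one, level_not] using (h1 (level (χ (x, 0)) c.2)).symm
      · simpa [SameCircle, smoothEnd, allA, hχ.apply_two, hχ.apply_three, level_not] using
          h2 (level (χ (x, 0)) c.2)
      · simpa [SameCircle, smoothEnd, allA, hχ.apply_two, hχ.apply_three, level_not] using
          (h2 (level (χ (x, 0)) c.2)).symm) c.1
  left_inv := by
    rintro ⟨z⟩
    change Quot.mk _ (boundaryEnd m (outerStrand z).1
      (level (χ (outerStrand z).1) (level (χ (outerStrand z).1) (outerStrand z).2))) = _
    rw [level_level]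
    exact (sameCircle_outerStrand z).symm
  right_inv := by
    rintro ⟨⟨d⟩, i⟩
    exact (cableLabel_boundaryEnd hχ d _).trans (by rw [level_level])

theorem circleCount_cable_allA {χ : D.End → Bool} (hχ : D.IsColoring χ) (m : ℕ) :
    (D.cable m).circleCount (D.cable m).allA = m * D.circleCount D.allA := by
  have h : (D.cable m).freeCircles = m * D.freeCircles := rfl
  rw [circleCount_eq, circleCount_eq, Nat.card_congr (cableCircleEquiv hχ m), Nat.card_prod,
    Nat.card_fin, h]
  ring

/-- The loops of the all-A state graph of a cable come from loops of the diagram, and they lie on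
the diagonals of the grids. -/
theorem loop_of_cable_loop {χ : D.End → Bool} (hχ : D.IsColoring χ) {x : D.Crossing} {p q : Fin m}
    (h : (D.cable m).SameCircle (D.cable m).allA (cell x (p, q), 0) (cell x (p, q), 2)) :
    p = q ∧ D.SameCircle D.allA (x, 0) (x, 2) := by
  have hlabel := cableLabel_eq hχ h
  have hlevel : ∀ (b : Bool) {i j : Fin m}, level b i = level b j → (i : ℕ) = j := by
    intro b i j hij
    rw [← level_level b i, hij, level_level]
  rw [cableLabel, cableLabel, outerStrand_low x _ _ (by decide),
    outerStrand_high x _ _ (by decide)] at hlabel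
  -- Off the diagonal both arcs run to the same side of the grid, on adjacent strands and hence at
  -- different levels. On the diagonal they run to opposite sides, each as strand 0.
  rcases lt_trichotomy (p : ℕ) q with hpq | hpq | hpq
  · rw [if_neg (by omega), if_pos hpq.le] at hlabel
    have := hlevel _ (congrArg Prod.snd hlabel)
    simp only at this
    omega
  · rw [if_pos hpq.ge, if_pos hpq.le] at hlabel
    exact ⟨Fin.ext hpq, congrArg Prod.fst hlabel⟩
  · rw [if_pos hpq.le, if_neg (by omega)] at hlabel
    have := hlevel _ (congrArg Prod.snd hlabel)
    simp only at this
    omega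

/-- The two innermost strands of a grid after smoothing some of the crossings on the diagonal in
the B-way: as far as their ends are concerned, they look like the smoothing of a single crossing. -/
theorem sameCircle_diagonal {s : (D.cable m).State} {y : D.Crossing}
    (hs : ∀ p q : Fin m, p ≠ q → s (cell y (p, q)) = true) (k : ℕ) : ∀ hk : k < m,
    ((∀ (j : ℕ) (hj : j ≤ k), s (cell y (⟨j, by omega⟩, ⟨j, by omega⟩)) = true) ∧
      (D.cable m).SameCircle s (cell y (⟨0, by omega⟩, ⟨0, by omega⟩), 0)
        (cell y (⟨k, hk⟩, ⟨k, hk⟩), 1) ∧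
      (D.cable m).SameCircle s (cell y (⟨0, by omega⟩, ⟨0, by omega⟩), 3)
        (cell y (⟨k, hk⟩, ⟨k, hk⟩), 2)) ∨
    ((∃ (j : ℕ) (hj : j ≤ k), s (cell y (⟨j, by omega⟩, ⟨j, by omega⟩)) = false) ∧
      (D.cable m).SameCircle s (cell y (⟨0, by omega⟩, ⟨0, by omega⟩), 0)
        (cell y (⟨0, by omega⟩, ⟨0, by omega⟩), 3) ∧
      (D.cable m).SameCircle s (cell y (⟨k, hk⟩, ⟨k, hk⟩), 1)
        (cell y (⟨k, hk⟩, ⟨k, hk⟩), 2)) := by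
  induction k with
  | zero =>
    intro hk
    cases h : s (cell y (⟨0, hk⟩, ⟨0, hk⟩))
    · exact Or.inr ⟨⟨0, le_rfl, h⟩, sameCircle_zero_three h, sameCircle_one_two h⟩
    · refine Or.inl ⟨fun j hj => ?_, sameCircle_zero_one h, (sameCircle_two_three h).symm⟩
      obtain rfl : j = 0 := by omega
      exact h
  | succ k ih =>
    intro hk
    have h1 := sameCircle_diagonal_one (s := s) (x := y) hk hk (hs _ _ (by simp))
    have h2 := sameCircle_diagonal_two (s := s) (x := y) hk hk (hs _ _ (by simp))
    rcases ih (by omega) with ⟨hall, h01, h32⟩ | ⟨⟨j, hj, hjs⟩, h03, h12⟩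
    · cases h : s (cell y (⟨k + 1, hk⟩, ⟨k + 1, hk⟩))
      · exact Or.inr ⟨⟨k + 1, le_rfl, h⟩,
          (h01.trans h1).trans ((sameCircle_zero_three h).trans (h32.trans h2).symm),
          sameCircle_one_two h⟩
      · refine Or.inl ⟨fun j hj => ?_, (h01.trans h1).trans (sameCircle_zero_one h),
          (h32.trans h2).trans (sameCircle_two_three h).symm⟩
        rcases hj.lt_or_eq with hj | rfl
        · exact hall j (by omega)
        · exact h
    · refine Or.inr ⟨⟨j, by omega, hjs⟩, h03, ?_⟩
      cases h : s (cell y (⟨k + 1, hk⟩, ⟨k + 1, hk⟩))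
      · exact sameCircle_one_two h
      · exact (sameCircle_zero_one h).symm.trans (h1.symm.trans (h12.trans (h2.trans
          (sameCircle_two_three h).symm)))

/-- In a cable with at least two strands, the loop at a corner cell stays a loop whichever other
loops of the all-A state graph are switched. -/
theorem sameCircle_cable_corner {o : D.End → Bool} (hglue : ∀ d, o (D.glue d) = !o d)
    (hplanar : D.IsPlanar) {χ : D.End → Bool} (hχ : D.IsColoring χ) (hm : 2 ≤ m)
    {x : D.Crossing} (hx : χ (x, 0) = false) (hloop : D.SameCircle D.allA (x, 0) (x, 2))
    {s : (D.cable m).State}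
    (hs : ∀ z, s z = false → (D.cable m).SameCircle (D.cable m).allA (z, 0) (z, 2))
    (hsx : s (cell x (⟨0, by omega⟩, ⟨0, by omega⟩)) = true) :
    (D.cable m).SameCircle s (cell x (⟨0, by omega⟩, ⟨0, by omega⟩), 0)
      (cell x (⟨0, by omega⟩, ⟨0, by omega⟩), 2) := by
  classical
  have hoff : ∀ (y : D.Crossing) (p q : Fin m), p ≠ q → s (cell y (p, q)) = true := by
    intro y p q hpq
    by_contra h
    exact hpq (loop_of_cable_loop hχ (hs _ (by simpa using h))).1
  -- The shadow of `s` on `D`: a crossing of the relevant colour counts as switched as soon as one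
  -- cell of its diagonal is.
  let t : D.State := fun y =>
    if χ (y, 0) = false ∧ ∃ p, s (cell y (p, p)) = false then false else true
  have ht : ∀ y, t y = false → χ (y, 0) = false ∧ ∃ p, s (cell y (p, p)) = false := by
    intro y hy
    by_contra h
    simp [t, h] at hy
  have ht' : ∀ y, t y = true → χ (y, 0) = false → ∀ p, s (cell y (p, p)) = true := by
    intro y hy hχy p
    by_contra h
    simp only [t, hχy, true_and] at hy
    rw [if_pos ⟨p, by simpa using h⟩] at hy
    exact absurd hy (by decide)
  have hcase0 : ∀ y, t y = true → χ (y, 0) = false →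
      (D.cable m).SameCircle s (cell y (⟨0, by omega⟩, ⟨0, by omega⟩), 0)
        (cell y (⟨m - 1, by omega⟩, ⟨m - 1, by omega⟩), 1) ∧
      (D.cable m).SameCircle s (cell y (⟨0, by omega⟩, ⟨0, by omega⟩), 3)
        (cell y (⟨m - 1, by omega⟩, ⟨m - 1, by omega⟩), 2) := by
    intro y hy hχy
    rcases sameCircle_diagonal (hoff y) (m - 1) (by omega) with ⟨-, h⟩ | ⟨⟨j, hj, h⟩, -⟩
    · exact h
    · simp [ht' y hy hχy] at h
  have hcase1 : ∀ y, t y = false →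
      (D.cable m).SameCircle s (cell y (⟨0, by omega⟩, ⟨0, by omega⟩), 0)
        (cell y (⟨0, by omega⟩, ⟨0, by omega⟩), 3) ∧
      (D.cable m).SameCircle s (cell y (⟨m - 1, by omega⟩, ⟨m - 1, by omega⟩), 1)
        (cell y (⟨m - 1, by omega⟩, ⟨m - 1, by omega⟩), 2) := by
    intro y hy
    obtain ⟨-, p, hp⟩ := ht y hy
    rcases sameCircle_diagonal (hoff y) (m - 1) (by omega) with ⟨h, -⟩ | ⟨-, h⟩
    · have := h p (by omega)
      simp [hp] at this
    · exact h
  let z : Fin m := ⟨0, by omega⟩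
  have hzrev : z.rev = ⟨m - 1, by omega⟩ := by ext; simp [z, Fin.val_rev]
  -- `g` lifts `D` to the copy at level 0, to which all diagonal loops with `χ (y, 0) = false` are
  -- attached. It carries circles of `t` into circles of `s`.
  let g : D.End → (D.cable m).End := fun d => boundaryEnd m d (level (χ d) z)
  have hg : ∀ {d e}, D.SameCircle t d e → (D.cable m).SameCircle s (g d) (g e) := by
    intro d e h
    refine h.map_sameCircle (g := g) ?_ ?_
    · intro d
      simp only [g]
      rw [hχ.2, level_not]
      exact (sameCircle_boundaryEnd _ _ _).symm
    rintro ⟨y, k⟩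
    cases hχy : χ (y, 0)
    · have e0 : g (y, 0) = (cell y (z, z), 0) := by
        simp only [g, hχy, boundaryEnd_zero, level]
        rfl
      have e1 : g (y, 1) = (cell y (⟨m - 1, by omega⟩, ⟨m - 1, by omega⟩), 1) := by
        simp [g, hχ.apply_one, hχy, boundaryEnd_one, level, hzrev]
      have e2 : g (y, 2) = (cell y (⟨m - 1, by omega⟩, ⟨m - 1, by omega⟩), 2) := by
        simp [g, hχ.apply_two, hχy, boundaryEnd_two, level, hzrev]
      have e3 : g (y, 3) = (cell y (z, z), 3) := by
        simp [g, hχ.apply_three, hχy, boundaryEnd_three, level, z]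
      cases hty : t y
      · obtain ⟨h1, h2⟩ := hcase1 y hty
        fin_cases k <;> simp only [smooth, hty, smoothEnd]
        · exact e0 ▸ e3 ▸ h1.symm
        · exact e1 ▸ e2 ▸ h2.symm
        · exact e1 ▸ e2 ▸ h2
        · exact e0 ▸ e3 ▸ h1
      · obtain ⟨h1, h2⟩ := hcase0 y hty hχy
        fin_cases k <;> simp only [smooth, hty, smoothEnd]
        · exact e0 ▸ e1 ▸ h1.symm
        · exact e0 ▸ e1 ▸ h1
        · exact e2 ▸ e3 ▸ h2
        · exact e2 ▸ e3 ▸ h2.symm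
    -- At crossings of the other colour, level 0 passes through the cells `(m - 1, 0)` and `(0, m -
    -- 1)`. Since `m ≥ 2`, these are off the diagonal and so keep their A-resolution.
    · have hty : t y = true := by simp [t, hχy]
      have e0 : g (y, 0) = (cell y (⟨m - 1, by omega⟩, z), 0) := by
        simp [g, hχy, boundaryEnd_zero, level, hzrev, z]
      have e1 : g (y, 1) = (cell y (⟨m - 1, by omega⟩, z), 1) := by
        simp [g, hχ.apply_one, hχy, boundaryEnd_one, level]
      have e2 : g (y, 2) = (cell y (z, ⟨m - 1, by omega⟩), 2) := by
        simp [g, hχ.apply_two, hχy, boundaryEnd_two, level]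
      have e3 : g (y, 3) = (cell y (z, ⟨m - 1, by omega⟩), 3) := by
        simp [g, hχ.apply_three, hχy, boundaryEnd_three, level, hzrev, z]
      have h1 := sameCircle_zero_one (hoff y ⟨m - 1, by omega⟩ z (by simp [z]; omega))
      have h2 := sameCircle_two_three (hoff y z ⟨m - 1, by omega⟩ (by simp [z]; omega))
      fin_cases k <;> simp only [smooth, hty, smoothEnd]
      · exact e0 ▸ e1 ▸ h1.symm
      · exact e0 ▸ e1 ▸ h1
      · exact e2 ▸ e3 ▸ h2.symm
      · exact e2 ▸ e3 ▸ h2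
  -- If another diagonal cell at `x` is switched, the strand turns back there and joins ends 0 and 3
  -- of the corner. Otherwise the loop at `x` in the shadow state is lifted by `g`.
  cases htx : t x
  · exact (hcase1 x htx).1.trans (sameCircle_two_three hsx).symm
  · have h := hg (sameCircle_of_loops hglue hplanar hχ false _ t rfl (fun y hy => by
      obtain ⟨hχy, p, hp⟩ := ht y hy
      exact ⟨hχy, (loop_of_cable_loop hχ (hs _ hp)).2⟩) x htx hx hloop)
    have e0 : g (x, 0) = (cell x (z, z), 0) := by
      simp only [g, hx, boundaryEnd_zero, level]
      rfl
    have e2 : g (x, 2) = (cell x (⟨m - 1, by omega⟩, ⟨m - 1, by omega⟩), 2) := by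
      simp [g, hχ.apply_two, hx, boundaryEnd_two, level, hzrev]
    rw [e0, e2] at h
    exact h.trans ((hcase0 x htx hx).2.symm.trans (sameCircle_two_three hsx).symm)

/-- If a plane diagram is not A-adequate, then its cables with at least two strands have a crossing
whose smoothing arcs lie on the same circle, in the all-A state and after switching any other loops
of the all-A state graph. -/
theorem exists_persistent_loop {o : D.End → Bool} (hglue : ∀ d, o (D.glue d) = !o d)
    (hplanar : D.IsPlanar) (hm : 2 ≤ m) (hD : ¬ D.AAdequate) :
    ∃ z : (D.cable m).Crossing, ∀ s : (D.cable m).State,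
      (∀ y, s y = false → (D.cable m).SameCircle (D.cable m).allA (y, 0) (y, 2)) → s z = true →
        (D.cable m).SameCircle s (z, 0) (z, 2) := by
  obtain ⟨χ, hχ⟩ := exists_isColoring hglue hplanar
  simp only [AAdequate, edgeEnds_isDiag_iff, not_forall, not_not] at hD
  obtain ⟨x, hloop⟩ := hD
  refine ⟨cell x (⟨0, by omega⟩, ⟨0, by omega⟩), fun s hs hsx => ?_⟩
  -- Negating the colouring exchanges the two sides, so the same corner cell serves for both
  -- colours.
  cases hx : χ (x, 0)
  · exact sameCircle_cable_corner hglue hplanar hχ hm hx hloop hs hsx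
  · exact sameCircle_cable_corner hglue hplanar hχ.not hm (by simp [hx]) hloop hs hsx

/-- Cables of A-adequate diagrams are A-adequate. -/
theorem AAdequate.cable {χ : D.End → Bool} (hχ : D.IsColoring χ) (hD : D.AAdequate)
    (m : ℕ) : (D.cable m).AAdequate := by
  intro y h
  obtain ⟨x, p, q, rfl⟩ := exists_cell y
  rw [edgeEnds_isDiag_iff] at h
  exact hD x ((edgeEnds_isDiag_iff _ _).2 (loop_of_cable_loop hχ h).2)

end Diagram

end LinkDiag

/-! ### Degrees of weights and of the bracket. -/

open WithZero

namespace LinkDiag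

noncomputable section

open Classical in
/-- The valuation of a rational function given by its degree. -/
def degreeValuation : Valuation (RatFunc ℚ) (WithZero (Multiplicative ℤ)) :=
  RatFunc.inftyValuation ℚ

theorem degreeValuation_of_ne_zero {f : RatFunc ℚ} (hf : f ≠ 0) :
    degreeValuation f = exp f.intDegree := by
  classical
  exact RatFunc.inftyValuation_of_nonzero ℚ hf

theorem degreeValuation_X_zpow (k : ℤ) : degreeValuation ((RatFunc.X : RatFunc ℚ) ^ k) = exp k := by
  rw [map_zpow₀, degreeValuation_of_ne_zero RatFunc.X_ne_zero, RatFunc.intDegree_X, ← exp_zsmul]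
  simp

/-- The bracket of a crossingless curve that is added to a nonempty diagram. -/
def loopValue : RatFunc ℚ := -RatFunc.X ^ 2 - RatFunc.X ^ (-2 : ℤ)

theorem degreeValuation_loopValue : degreeValuation loopValue = exp 2 := by
  have h2 : degreeValuation ((RatFunc.X : RatFunc ℚ) ^ 2) = exp 2 := by
    exact_mod_cast degreeValuation_X_zpow 2
  rw [loopValue, sub_eq_add_neg, Valuation.map_add_eq_of_lt_left, Valuation.map_neg, h2]
  rw [Valuation.map_neg, Valuation.map_neg, h2, degreeValuation_X_zpow]
  exact exp_lt_exp.2 (by norm_num)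

theorem degreeValuation_intCast_le (a : ℤ) : degreeValuation (a : RatFunc ℚ) ≤ 1 := by
  by_cases ha : a = 0
  · simp [ha]
  · have : (a : RatFunc ℚ) = RatFunc.C (a : ℚ) := by simp
    rw [degreeValuation_of_ne_zero (by exact_mod_cast ha), this, RatFunc.intDegree_C, exp_zero]

theorem maxDegree_eq_iff (f : RatFunc ℚ) (N : ℤ) : maxDegree f = N ↔ degreeValuation f = exp N := by
  by_cases hf : f = 0
  · simp [maxDegree, hf, exp_ne_zero.symm]
  · rw [maxDegree, if_neg hf, degreeValuation_of_ne_zero hf, exp_inj]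
    exact WithBot.coe_inj

namespace Diagram

variable {D : Diagram}

/-- The contribution of a state to the bracket. -/
def weight (s : D.State) : RatFunc ℚ :=
  RatFunc.X ^ D.stateExponent s * loopValue ^ ((D.circleCount s : ℤ) - 1)

theorem bracket_eq_sum_weight (D : Diagram) : D.bracket = ∑ s : D.State, weight s := rfl

theorem stateExponent_eq (s : D.State) :
    D.stateExponent s = Fintype.card D.Crossing - 2 * bCount s := by
  have h : ∀ x, (if s x then (1 : ℤ) else -1) = 1 - 2 * if s x = false then 1 else 0 := by
    intro x
    cases s x <;> simp
  rw [stateExponent, Finset.sum_congr rfl fun x _ => h x, Finset.sum_sub_distrib,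
    ← Finset.mul_sum, Finset.sum_boole]
  simp [bCount]

/-- The largest degree that the bracket may have. -/
def degreeBound (D : Diagram) : ℤ := Fintype.card D.Crossing + 2 * D.circleCount D.allA - 2

theorem degreeValuation_weight (s : D.State) :
    degreeValuation (weight s) = exp ((Fintype.card D.Crossing : ℤ) - 2 * bCount s +
      2 * ((D.circleCount s : ℤ) - 1)) := by
  rw [weight, map_mul, map_zpow₀ _ loopValue, degreeValuation_loopValue, degreeValuation_X_zpow,
    ← exp_zsmul, ← exp_add, stateExponent_eq, smul_eq_mul]
  ring_nf

theorem degreeValuation_weight_le {χ : D.End → Bool} (hχ : D.IsColoring χ) (s : D.State) :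
    degreeValuation (weight s) ≤ exp D.degreeBound := by
  have := circleCount_le hχ s
  rw [degreeValuation_weight, exp_le_exp, degreeBound]
  omega

theorem degreeValuation_weight_lt {χ : D.End → Bool} (hχ : D.IsColoring χ) {s : D.State}
    {x : D.Crossing} (hx : s x = false) (hloop : ¬ D.SameCircle D.allA (x, 0) (x, 2)) :
    degreeValuation (weight s) < exp D.degreeBound := by
  have := circleCount_add_two_le hχ hx hloop
  rw [degreeValuation_weight, exp_lt_exp, degreeBound]
  omega

theorem degreeValuation_bracket_le {χ : D.End → Bool} (hχ : D.IsColoring χ) :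
    degreeValuation D.bracket ≤ exp D.degreeBound := by
  rw [bracket_eq_sum_weight]
  exact Valuation.map_sum_le _ fun s _ => degreeValuation_weight_le hχ s

/-- Every state other than all-A switches some crossing, which is not a loop, so the all-A term
cannot be cancelled. -/
theorem degreeValuation_bracket_of_aAdequate {χ : D.End → Bool} (hχ : D.IsColoring χ)
    (hD : D.AAdequate) : degreeValuation D.bracket = exp D.degreeBound := by
  have hA : degreeValuation (weight D.allA) = exp D.degreeBound := by
    rw [degreeValuation_weight, bCount_allA, degreeBound]
    congr 1
    push_cast
    ring
  rw [bracket_eq_sum_weight, ← Finset.add_sum_erase _ _ (Finset.mem_univ D.allA),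
    Valuation.map_add_eq_of_lt_left, hA]
  rw [hA]
  refine Valuation.map_sum_lt _ exp_ne_zero fun s hs => ?_
  obtain ⟨x, hx⟩ : ∃ x, s x = false := by
    by_contra! h
    exact Finset.ne_of_mem_erase hs (funext fun x => by simpa [allA] using h x)
  exact degreeValuation_weight_lt hχ hx fun h => hD x ((edgeEnds_isDiag_iff _ _).2 h)

theorem one_add_loopValue : 1 + RatFunc.X ^ (-2 : ℤ) * loopValue = -RatFunc.X ^ (-4 : ℤ) := by
  have hX : (RatFunc.X : RatFunc ℚ) ≠ 0 := RatFunc.X_ne_zero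
  rw [loopValue]
  field_simp
  ring

/-- Switching `z` splits a circle and multiplies the weight by `X⁻² * loopValue`, whose leading term
is `-1`. What remains of the sum is `-X⁻⁴` times the first weight. -/
theorem weight_add_weight_toggle_lt {χ : D.End → Bool} (hχ : D.IsColoring χ) {s : D.State}
    {z : D.Crossing} (hz : s z = true) (h : D.SameCircle s (z, 0) (z, 2)) :
    degreeValuation (weight s + weight (toggle s z)) < exp D.degreeBound := by
  have hX : (RatFunc.X : RatFunc ℚ) ≠ 0 := RatFunc.X_ne_zero
  have hl : loopValue ≠ 0 := by
    rw [← Valuation.ne_zero_iff degreeValuation, degreeValuation_loopValue]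
    exact exp_ne_zero
  have h1 : weight (toggle s z) = weight s * (RatFunc.X ^ (-2 : ℤ) * loopValue) := by
    have h2 : D.stateExponent (toggle s z) = D.stateExponent s + (-2) := by
      rw [stateExponent_eq, stateExponent_eq, bCount_toggle hz]
      push_cast
      ring
    have h3 : (D.circleCount (toggle s z) : ℤ) - 1 = (D.circleCount s - 1) + 1 := by
      rw [circleCount_toggle_of_sameCircle hχ h]
      push_cast
      ring
    rw [weight, weight, h2, h3, zpow_add₀ hX, zpow_add₀ hl, zpow_one]
    ring
  have h4 : weight s + weight (toggle s z) = weight s * -RatFunc.X ^ (-4 : ℤ) := by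
    rw [h1, ← one_add_loopValue]
    ring
  have h5 := circleCount_le hχ s
  rw [h4, map_mul, Valuation.map_neg, degreeValuation_X_zpow, degreeValuation_weight, ← exp_add,
    exp_lt_exp, degreeBound]
  omega

/-- Pair each state with the one differing at `z`. If some crossing other than `z` is switched
without being a loop, both weights are already below the bound; otherwise their top terms cancel. -/
theorem degreeValuation_bracket_lt {χ : D.End → Bool} (hχ : D.IsColoring χ) {z : D.Crossing}
    (hz : ∀ s : D.State, (∀ y, s y = false → D.SameCircle D.allA (y, 0) (y, 2)) → s z = true →
      D.SameCircle s (z, 0) (z, 2)) : degreeValuation D.bracket < exp D.degreeBound := by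
  have hpair : ∀ s : D.State, s z = true →
      degreeValuation (weight s + weight (toggle s z)) < exp D.degreeBound := by
    intro s hsz
    by_cases hs : ∀ y, s y = false → D.SameCircle D.allA (y, 0) (y, 2)
    · exact weight_add_weight_toggle_lt hχ hsz (hz s hs hsz)
    · push Not at hs
      obtain ⟨y, hy, hloop⟩ := hs
      have hyz : y ≠ z := by
        rintro rfl
        simp [hsz] at hy
      exact Valuation.map_add_lt _ (degreeValuation_weight_lt hχ hy hloop)
        (degreeValuation_weight_lt hχ (by rwa [toggle_of_ne s hyz]) hloop)
  have hpair' : ∀ s : D.State, degreeValuation (weight s + weight (toggle s z)) < exp D.degreeBound := by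
    intro s
    cases hsz : s z
    · have := hpair (toggle s z) (by simp [toggle_self, hsz])
      rwa [toggle_toggle, add_comm] at this
    · exact hpair s hsz
  have htoggle : ∑ s : D.State, weight (toggle s z) = ∑ s : D.State, weight s :=
    Equiv.sum_comp (Function.Involutive.toPerm (toggle · z) fun s => toggle_toggle s z) weight
  -- Summing over all states counts every pair twice, which is harmless because the constant 2 has
  -- degree zero.
  have htwo : 2 * D.bracket = ∑ s : D.State, (weight s + weight (toggle s z)) := by
    rw [Finset.sum_add_distrib, htoggle, ← bracket_eq_sum_weight, two_mul]
  have h2 : degreeValuation (2 : RatFunc ℚ) = 1 := by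
    have := RatFunc.intDegree_C (2 : ℚ)
    rw [map_ofNat] at this
    rw [degreeValuation_of_ne_zero two_ne_zero, this, exp_zero]
  have h3 : degreeValuation D.bracket = degreeValuation (2 * D.bracket) := by rw [map_mul, h2, one_mul]
  rw [h3, htwo]
  exact Valuation.map_sum_lt _ exp_ne_zero fun s _ => hpair' s

theorem degreeBound_cable {χ : D.End → Bool} (hχ : D.IsColoring χ) (m : ℕ) :
    (D.cable m).degreeBound =
      Fintype.card D.Crossing * m ^ 2 + 2 * m * D.circleCount D.allA - 2 := by
  have h : Fintype.card (D.cable m).Crossing = Fintype.card D.Crossing * (m * m) := by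
    have h' : Nat.card (D.cable m).Crossing = Nat.card (D.Crossing × Fin m × Fin m) := rfl
    rw [← Nat.card_eq_fintype_card, h', Nat.card_prod, Nat.card_prod, Nat.card_fin,
      Nat.card_eq_fintype_card]
  rw [degreeBound, circleCount_cable_allA hχ, h]
  push_cast
  ring

end Diagram

/-! ### From cables to Chebyshev combinations and the maximum degree. -/

theorem chebyshev_S_monic_natDegree (n : ℕ) : (Polynomial.Chebyshev.S ℤ n).Monic ∧
    (Polynomial.Chebyshev.S ℤ n).natDegree = n := by
  induction n using Nat.twoStepInduction with
  | zero => simp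
  | one => simp [Polynomial.monic_X]
  | more n ih1 ih2 =>
    have hmul : (Polynomial.X * Polynomial.Chebyshev.S ℤ (n + 1 : ℕ)).Monic :=
      Polynomial.monic_X.mul ih2.1
    have hdeg : (Polynomial.X * Polynomial.Chebyshev.S ℤ (n + 1 : ℕ)).natDegree = n + 2 := by
      rw [Polynomial.monic_X.natDegree_mul ih2.1, Polynomial.natDegree_X, ih2.2]
      ring
    have hlt : (Polynomial.Chebyshev.S ℤ n).natDegree <
        (Polynomial.X * Polynomial.Chebyshev.S ℤ (n + 1 : ℕ)).natDegree := by
      rw [hdeg, ih1.2]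
      omega
    have heq : Polynomial.Chebyshev.S ℤ (n + 2 : ℕ) =
        Polynomial.X * Polynomial.Chebyshev.S ℤ (n + 1 : ℕ) - Polynomial.Chebyshev.S ℤ n := by
      push_cast
      exact Polynomial.Chebyshev.S_add_two ℤ n
    rw [heq]
    exact ⟨hmul.sub_of_left (Polynomial.degree_lt_degree hlt),
      (Polynomial.natDegree_sub_eq_left_of_natDegree_lt hlt).trans hdeg⟩

namespace Diagram

variable {D : Diagram}

/-- The bracket of the `n`-cable dominates the bracket of `S_n(D)`. -/
theorem degreeValuation_chebyshevBracket_eq_iff {χ : D.End → Bool} (hχ : D.IsColoring χ)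
    (hD : 0 < D.circleCount D.allA) (n : ℕ) :
    degreeValuation (D.chebyshevBracket n) = exp (D.cable n).degreeBound ↔
      degreeValuation (D.cable n).bracket = exp (D.cable n).degreeBound := by
  obtain ⟨hmonic, hdeg⟩ := chebyshev_S_monic_natDegree n
  have hcoeff : (Polynomial.Chebyshev.S ℤ n).coeff n = 1 := by
    rw [Polynomial.Monic, Polynomial.leadingCoeff, hdeg] at hmonic
    exact hmonic
  have hmem : n ∈ (Polynomial.Chebyshev.S ℤ n).support := by simp [hcoeff]
  have hsum : D.chebyshevBracket n = (D.cable n).bracket +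
      ∑ k ∈ (Polynomial.Chebyshev.S ℤ n).support.erase n,
        ((Polynomial.Chebyshev.S ℤ n).coeff k : RatFunc ℚ) * (D.cable k).bracket := by
    rw [chebyshevBracket, Polynomial.sum_def, ← Finset.add_sum_erase _ _ hmem, hcoeff]
    simp
  have hlt : degreeValuation (∑ k ∈ (Polynomial.Chebyshev.S ℤ n).support.erase n,
      ((Polynomial.Chebyshev.S ℤ n).coeff k : RatFunc ℚ) * (D.cable k).bracket) <
        exp (D.cable n).degreeBound := by
    refine Valuation.map_sum_lt _ exp_ne_zero fun k hk => ?_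
    have hkn : k < n := by
      have h1 := Polynomial.le_natDegree_of_mem_supp k (Finset.mem_of_mem_erase hk)
      have h2 := Finset.ne_of_mem_erase hk
      omega
    rw [map_mul]
    refine (mul_le_mul' (degreeValuation_intCast_le _)
      (degreeValuation_bracket_le (hχ.cable k))).trans_lt ?_
    rw [one_mul, exp_lt_exp, degreeBound_cable hχ, degreeBound_cable hχ]
    have h1 : (k : ℤ) < n := by exact_mod_cast hkn
    -- The term linear in the cabling number makes the comparison strict even without crossings;
    -- here the link must be nonempty.
    have h2 : (0 : ℤ) < D.circleCount D.allA := by exact_mod_cast hD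
    have h3 : (Fintype.card D.Crossing : ℤ) * k ^ 2 ≤ Fintype.card D.Crossing * n ^ 2 := by gcongr
    nlinarith
  rw [hsum]
  constructor
  · intro h
    refine le_antisymm (degreeValuation_bracket_le (hχ.cable n)) (not_lt.1 fun hcon => ?_)
    exact (Valuation.map_add_lt _ hcon hlt).ne h
  · intro h
    rw [Valuation.map_add_eq_of_lt_left, h]
    rwa [h]

theorem circleCount_allA_pos (h : Nonempty D.Crossing ∨ 0 < D.freeCircles) :
    0 < D.circleCount D.allA := by
  rw [circleCount_eq]
  rcases h with ⟨⟨x⟩⟩ | h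
  · have : Nonempty (Quot (D.StateStep D.allA)) := ⟨Quot.mk _ (x, 0)⟩
    have := Nat.card_pos (α := Quot (D.StateStep D.allA))
    omega
  · omega

end Diagram

namespace LinkDiagram

variable (D : LinkDiagram)

theorem cPos_add_cNeg : D.cPos + D.cNeg = Fintype.card D.Crossing := by
  classical
  rw [cPos, cNeg, ← Nat.card_sum, ← Nat.card_eq_fintype_card]
  exact Nat.card_congr (Equiv.sumCompl _)

/-- The writhe factor shifts the degree by `-w(n² + 2n)`, and the quadratic coefficient becomes `c₊
+ c₋ - w = 2c₋`. -/
theorem hMax_eq {χ : D.End → Bool} (hχ : D.IsColoring χ) (n : ℕ) :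
    D.hMax n = (D.cable n).degreeBound - D.writhe * (n ^ 2 + 2 * n) := by
  have h : (Fintype.card D.Crossing : ℤ) = D.cPos + D.cNeg := by
    exact_mod_cast D.cPos_add_cNeg.symm
  rw [Diagram.degreeBound_cable hχ, hMax, writhe, vA, h]
  ring

theorem dMax_eq_hMax_iff {χ : D.End → Bool} (hχ : D.IsColoring χ) (n : ℕ) :
    D.dMax n = (D.hMax n : WithBot ℤ) ↔
      degreeValuation (D.cable n).bracket = exp (D.cable n).degreeBound := by
  rw [← Diagram.degreeValuation_chebyshevBracket_eq_iff hχ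
    (Diagram.circleCount_allA_pos D.nonempty), dMax, maxDegree_eq_iff, G, map_mul, map_mul]
  have h1 : degreeValuation (((-1) ^ n * RatFunc.X ^ (n ^ 2 + 2 * n)) ^ (-D.writhe)) =
      exp (-(D.writhe * (n ^ 2 + 2 * n))) := by
    have h := degreeValuation_X_zpow (n ^ 2 + 2 * n : ℕ)
    rw [zpow_natCast] at h
    rw [map_zpow₀, map_mul, map_pow _ (-1 : RatFunc ℚ), Valuation.map_neg, map_one, one_pow,
      one_mul, h, ← exp_zsmul]
    congr 1
    push_cast
    simp
  have h2 : degreeValuation ((-1 : RatFunc ℚ) ^ ((n : ℤ) - 1)) = 1 := by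
    rw [map_zpow₀, Valuation.map_neg, map_one, one_zpow]
  rw [h1, h2, mul_one, D.hMax_eq hχ, sub_eq_neg_add, exp_add]
  exact mul_right_inj' exp_ne_zero

theorem dMax_eq_hMax_iff_aAdequate {n : ℕ} (hn : 2 ≤ n) :
    D.dMax n = (D.hMax n : WithBot ℤ) ↔ D.AAdequate := by
  obtain ⟨χ, hχ⟩ := Diagram.exists_isColoring D.outgoing_glue D.planar
  rw [D.dMax_eq_hMax_iff hχ]
  constructor
  · intro h
    by_contra hD
    obtain ⟨z, hz⟩ := Diagram.exists_persistent_loop D.outgoing_glue D.planar hn hD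
    exact (Diagram.degreeValuation_bracket_lt (hχ.cable n) hz).ne h
  · intro hD
    exact Diagram.degreeValuation_bracket_of_aAdequate (hχ.cable n)
      (Diagram.AAdequate.cable hχ hD n)

end LinkDiagram

/-! ### Mirror images and the minimum degree. -/

/-- Substitution of `X⁻¹` into a polynomial. -/
def evalInv : Polynomial ℚ →+* RatFunc ℚ := Polynomial.eval₂RingHom RatFunc.C RatFunc.X⁻¹

theorem evalInv_eq (p : Polynomial ℚ) : evalInv p =
    algebraMap (Polynomial ℚ) (RatFunc ℚ) p.reverse * RatFunc.X ^ (-(p.natDegree : ℤ)) := by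
  have hX : (RatFunc.X : RatFunc ℚ) ≠ 0 := RatFunc.X_ne_zero
  let _ : Invertible (RatFunc.X⁻¹ : RatFunc ℚ) := invertibleOfNonzero (inv_ne_zero hX)
  have h := Polynomial.eval₂_reverse_mul_pow RatFunc.C (RatFunc.X⁻¹ : RatFunc ℚ) p
  have h2 : Polynomial.eval₂ RatFunc.C (RatFunc.X : RatFunc ℚ) p.reverse =
      algebraMap (Polynomial ℚ) (RatFunc ℚ) p.reverse := by
    rw [Polynomial.eval₂_eq_sum_range]
    conv_rhs => rw [p.reverse.as_sum_range_C_mul_X_pow]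
    simp
  rw [invOf_eq_inv, inv_inv, h2] at h
  rw [zpow_neg, zpow_natCast, ← inv_pow]
  exact h.symm

theorem evalInv_ne_zero {p : Polynomial ℚ} (hp : p ≠ 0) : evalInv p ≠ 0 := by
  rw [evalInv_eq]
  exact mul_ne_zero (by simpa using hp) (zpow_ne_zero _ RatFunc.X_ne_zero)

/-- `p(X⁻¹)` is the reversed polynomial divided by `X ^ natDegree`, and reversal lowers the degree
by exactly the trailing degree. -/
theorem degreeValuation_evalInv {p : Polynomial ℚ} (hp : p ≠ 0) :
    degreeValuation (evalInv p) = exp (-(p.natTrailingDegree : ℤ)) := by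
  rw [evalInv_eq, map_mul, degreeValuation_X_zpow,
    degreeValuation_of_ne_zero (by simpa using hp), RatFunc.intDegree_polynomial, ← exp_add,
    Polynomial.reverse_natDegree]
  have := p.natTrailingDegree_le_natDegree
  congr 1
  omega

theorem nonZeroDivisors_le_comap_evalInv :
    nonZeroDivisors (Polynomial ℚ) ≤ (nonZeroDivisors (RatFunc ℚ)).comap evalInv := fun _ hp =>
  mem_nonZeroDivisors_of_ne_zero (evalInv_ne_zero (nonZeroDivisors.ne_zero hp))

/-- The substitution `X ↦ X⁻¹` on rational functions. -/
def invX : RatFunc ℚ →+* RatFunc ℚ :=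
  RatFunc.liftRingHom evalInv nonZeroDivisors_le_comap_evalInv

theorem invX_X : invX RatFunc.X = RatFunc.X⁻¹ := by
  rw [invX, RatFunc.liftRingHom_X]
  simp [evalInv]

theorem invX_X_zpow (k : ℤ) : invX (RatFunc.X ^ k) = RatFunc.X ^ (-k) := by
  rw [map_zpow₀, invX_X, inv_zpow, zpow_neg]

theorem invX_loopValue : invX loopValue = loopValue := by
  have h2 : (RatFunc.X : RatFunc ℚ) ^ 2 = RatFunc.X ^ (2 : ℤ) := by norm_cast
  rw [loopValue, map_sub, map_neg, h2, invX_X_zpow, invX_X_zpow]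
  ring_nf

theorem minDegree_eq_iff (f : RatFunc ℚ) (N : ℤ) :
    minDegree f = N ↔ maxDegree (invX f) = (-N : ℤ) := by
  rw [maxDegree_eq_iff]
  by_cases hf : f = 0
  · simp [minDegree, hf, exp_ne_zero.symm]
  · have hnum : f.num ≠ 0 := RatFunc.num_ne_zero hf
    have h : invX f = evalInv f.num / evalInv f.denom := by
      conv_lhs => rw [← RatFunc.num_div_denom f]
      rw [invX, RatFunc.liftRingHom_apply_div]
    rw [minDegree, if_neg hf, h, map_div₀, degreeValuation_evalInv hnum,
      degreeValuation_evalInv f.denom_ne_zero, ← exp_sub, exp_inj]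
    refine WithTop.coe_inj.trans ⟨fun h => ?_, fun h => ?_⟩ <;> omega

namespace Diagram

variable {D D' : Diagram}

/-- `D'` is a mirror image of `D`: the crossings are identified in such a way that the end `i` of
a crossing of `D'` is the end `i + 1` of the corresponding crossing of `D`, so that over-strands
become under-strands. -/
structure Mirror (D' D : Diagram) where
  /-- The correspondence of crossings. -/
  crossing : D'.Crossing ≃ D.Crossing
  glue_eq : ∀ x i, D.glue (crossing x, i + 1) =
    (crossing (D'.glue (x, i)).1, (D'.glue (x, i)).2 + 1)
  freeCircles_eq : D'.freeCircles = D.freeCircles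

/-- Rotating the labels of the ends by one turns A-arcs into B-arcs, so the mirror image exchanges
the two resolutions. -/
theorem smoothEnd_not (b : Bool) (i : Fin 4) : smoothEnd (!b) i + 1 = smoothEnd b (i + 1) := by
  cases b <;> fin_cases i <;> rfl

namespace Mirror

/-- The correspondence of ends. -/
def endEquiv (h : Mirror D' D) : D'.End ≃ D.End := h.crossing.prodCongr (Equiv.addRight 1)

theorem endEquiv_apply (h : Mirror D' D) (x : D'.Crossing) (i : Fin 4) :
    h.endEquiv (x, i) = (h.crossing x, i + 1) := rfl

theorem endEquiv_glue (h : Mirror D' D) (d : D'.End) :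
    h.endEquiv (D'.glue d) = D.glue (h.endEquiv d) := (h.glue_eq d.1 d.2).symm

/-- The correspondence of states. -/
def stateEquiv (h : Mirror D' D) : D.State ≃ D'.State where
  toFun s x := !s (h.crossing x)
  invFun s x := !s (h.crossing.symm x)
  left_inv s := by simp
  right_inv s := by simp

theorem stateEquiv_apply (h : Mirror D' D) (s : D.State) (x : D'.Crossing) :
    h.stateEquiv s x = !s (h.crossing x) := rfl

theorem endEquiv_smooth (h : Mirror D' D) (s : D.State) (d : D'.End) :
    h.endEquiv (D'.smooth (h.stateEquiv s) d) = D.smooth s (h.endEquiv d) := by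
  obtain ⟨x, i⟩ := d
  simp [smooth, endEquiv_apply, stateEquiv_apply, smoothEnd_not]

theorem stateStep_iff (h : Mirror D' D) (s : D.State) (d e : D'.End) :
    D'.StateStep (h.stateEquiv s) d e ↔ D.StateStep s (h.endEquiv d) (h.endEquiv e) := by
  have h1 : e = D'.glue d ↔ h.endEquiv e = D.glue (h.endEquiv d) := by
    rw [← endEquiv_glue, h.endEquiv.apply_eq_iff_eq]
  have h2 : e = D'.smooth (h.stateEquiv s) d ↔ h.endEquiv e = D.smooth s (h.endEquiv d) := by
    rw [← endEquiv_smooth, h.endEquiv.apply_eq_iff_eq]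
  exact or_congr h1 h2

/-- The correspondence of state circles. -/
def circleEquiv (h : Mirror D' D) (s : D.State) :
    Quot (D'.StateStep (h.stateEquiv s)) ≃ Quot (D.StateStep s) :=
  Quot.congr h.endEquiv (h.stateStep_iff s)

theorem circleCount_eq (h : Mirror D' D) (s : D.State) :
    D'.circleCount (h.stateEquiv s) = D.circleCount s := by
  rw [Diagram.circleCount_eq, Diagram.circleCount_eq, Nat.card_congr (h.circleEquiv s),
    h.freeCircles_eq]

theorem sameCircle_iff (h : Mirror D' D) (s : D.State) (d e : D'.End) :
    D'.SameCircle (h.stateEquiv s) d e ↔ D.SameCircle s (h.endEquiv d) (h.endEquiv e) :=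
  (h.circleEquiv s).apply_eq_iff_eq.symm

theorem stateExponent_eq (h : Mirror D' D) (s : D.State) :
    D'.stateExponent (h.stateEquiv s) = -D.stateExponent s := by
  rw [stateExponent, stateExponent, ← Finset.sum_neg_distrib]
  refine Fintype.sum_equiv h.crossing _ _ fun x => ?_
  rw [stateEquiv_apply]
  cases s (h.crossing x) <;> simp

/-- The bracket of the mirror image is obtained by substituting `X⁻¹`. -/
theorem bracket_eq (h : Mirror D' D) : D'.bracket = invX D.bracket := by
  rw [bracket_eq_sum_weight, bracket_eq_sum_weight, map_sum, ← Equiv.sum_comp h.stateEquiv]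
  refine Finset.sum_congr rfl fun s _ => ?_
  rw [weight, weight, map_mul, invX_X_zpow, map_zpow₀, invX_loopValue, h.stateExponent_eq,
    h.circleCount_eq]

theorem stateEquiv_allB (h : Mirror D' D) : h.stateEquiv D.allB = D'.allA := rfl

/-- Ends 0 and 2 of the mirror image are ends 1 and 3 of the diagram; the B-arcs connect these to
ends 2 and 0. -/
theorem bAdequate_iff (h : Mirror D' D) : D.BAdequate ↔ D'.AAdequate := by
  refine (h.crossing.forall_congr fun x => ?_).symm
  rw [edgeEnds_isDiag_iff, edgeEnds_isDiag_iff, ← h.stateEquiv_allB, h.sameCircle_iff]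
  have h1 : D.SameCircle D.allB (h.crossing x, 1) (h.crossing x, 2) := sameCircle_one_two rfl
  have h2 : D.SameCircle D.allB (h.crossing x, 0) (h.crossing x, 3) := sameCircle_zero_three rfl
  exact not_congr ⟨fun h3 => h2.trans (h3.symm.trans h1), fun h3 => h1.trans (h3.symm.trans h2)⟩

/-- The rotation of a grid by a quarter turn. -/
def rotateCell (m : ℕ) : Fin m × Fin m ≃ Fin m × Fin m where
  toFun c := (c.2.rev, c.1)
  invFun c := (c.2, c.1.rev)
  left_inv c := by simp
  right_inv c := by simp

theorem gridCoord_rotateCell (m : ℕ) (k : Fin 4) (c : Fin m × Fin m) :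
    gridCoord m (k + 1) (rotateCell m c) = gridCoord m k c := by
  fin_cases k <;> simp [gridCoord, rotateCell]

theorem gridCell_add_one (m : ℕ) (k : Fin 4) (ij : Fin m × Fin m) :
    gridCell m (k + 1) ij = rotateCell m (gridCell m k ij) := by
  fin_cases k <;> simp [gridCell, rotateCell]

/-- Cables of mirror images are mirror images of cables. -/
def cable (h : Mirror D' D) (m : ℕ) : Mirror (D'.cable m) (D.cable m) where
  crossing := h.crossing.prodCongr (rotateCell m)
  glue_eq := by
    rintro ⟨x, c⟩ k
    change D.cableGlue m ((h.crossing x, rotateCell m c), k + 1) =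
      ((h.crossing (D'.cableGlue m ((x, c), k)).1.1,
        rotateCell m (D'.cableGlue m ((x, c), k)).1.2), (D'.cableGlue m ((x, c), k)).2 + 1)
    simp only [cableGlue, gridCoord_rotateCell, h.glue_eq, gridCell_add_one]
    split_ifs
    · rfl
    · rw [add_right_comm]
  freeCircles_eq := congrArg (m * ·) h.freeCircles_eq

theorem chebyshevBracket_eq (h : Mirror D' D) (n : ℕ) :
    D'.chebyshevBracket n = invX (D.chebyshevBracket n) := by
  rw [chebyshevBracket, chebyshevBracket, Polynomial.sum_def, Polynomial.sum_def, map_sum]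
  refine Finset.sum_congr rfl fun k _ => ?_
  rw [map_mul, map_intCast, (h.cable k).bracket_eq]

end Mirror

/-- The mirror image of a diagram. -/
def mirror (D : Diagram) : Diagram where
  Crossing := D.Crossing
  glue d := ((D.glue (d.1, d.2 + 1)).1, (D.glue (d.1, d.2 + 1)).2 - 1)
  glue_glue d := by simp [D.glue_glue]
  glue_ne d h := by
    apply D.glue_ne (d.1, d.2 + 1)
    rw [Prod.ext_iff] at h ⊢
    exact ⟨h.1, sub_eq_iff_eq_add.1 h.2⟩
  freeCircles := D.freeCircles

/-- The identification of the crossings of a diagram and its mirror image. -/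
def mirrorMirror (D : Diagram) : Mirror D.mirror D where
  crossing := Equiv.refl _
  glue_eq x i := by
    change D.glue (x, i + 1) = ((D.glue (x, i + 1)).1, (D.glue (x, i + 1)).2 - 1 + 1)
    rw [sub_add_cancel]
  freeCircles_eq := rfl

theorem IsPlanar.mirror (h : D.IsPlanar) : D.mirror.IsPlanar := by
  have hface : D.mirror.faceCount = D.faceCount := by
    refine Nat.card_congr (Quot.congr D.mirrorMirror.endEquiv fun d e => ?_)
    rw [← D.mirrorMirror.endEquiv_glue]
    exact D.mirrorMirror.endEquiv.apply_eq_iff_eq.symm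
  have hcomp : D.mirror.graphComponentCount = D.graphComponentCount := by
    refine Nat.card_congr (Quot.congr D.mirrorMirror.crossing fun x y => ?_)
    exact (Equiv.addRight (1 : Fin 4)).exists_congr fun i => Iff.rfl
  have hcard : Fintype.card D.mirror.Crossing = Fintype.card D.Crossing := rfl
  rw [IsPlanar, hface, hcomp, hcard]
  exact h

end Diagram

namespace LinkDiagram

variable (D : LinkDiagram)

/-- The mirror image of a link diagram. -/
def mirror : LinkDiagram where
  toDiagram := D.toDiagram.mirror
  outgoing d := D.outgoing (d.1, d.2 + 1)
  outgoing_opposite x i := by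
    rw [add_right_comm]
    exact D.outgoing_opposite x (i + 1)
  outgoing_glue d := by
    change D.outgoing ((D.glue (d.1, d.2 + 1)).1, (D.glue (d.1, d.2 + 1)).2 - 1 + 1) = _
    rw [sub_add_cancel]
    exact D.outgoing_glue _
  planar := D.planar.mirror
  nonempty := D.nonempty

theorem isPositive_mirror (x : D.Crossing) : D.mirror.IsPositive x ↔ ¬ D.IsPositive x := by
  change D.outgoing (x, 2) = D.outgoing (x, 3) ↔ ¬ D.outgoing (x, 1) = D.outgoing (x, 2)
  have h : D.outgoing (x, 3) = !D.outgoing (x, 1) := D.outgoing_opposite x 1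
  rw [h]
  cases D.outgoing (x, 1) <;> cases D.outgoing (x, 2) <;> simp

theorem cPos_mirror : D.mirror.cPos = D.cNeg :=
  Nat.card_congr (Equiv.subtypeEquivRight D.isPositive_mirror)

theorem cNeg_mirror : D.mirror.cNeg = D.cPos :=
  Nat.card_congr (Equiv.subtypeEquivRight fun x =>
    (not_congr (D.isPositive_mirror x)).trans not_not)

theorem writhe_mirror : D.mirror.writhe = -D.writhe := by
  rw [writhe, writhe, cPos_mirror, cNeg_mirror]
  ring

theorem vA_mirror : D.mirror.vA = D.vB :=
  D.toDiagram.mirrorMirror.circleCount_eq D.allB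

theorem hMax_mirror (n : ℕ) : D.mirror.hMax n = -D.hMin n := by
  rw [hMax, hMin, cNeg_mirror, vA_mirror, writhe_mirror]
  ring

/-- The substitution inverts the normalizing factor, while mirroring changes the sign of its
exponent; the two effects agree. -/
theorem G_mirror (n : ℕ) : D.mirror.G n = invX (D.G n) := by
  have h1 : D.mirror.chebyshevBracket n = invX (D.chebyshevBracket n) :=
    D.toDiagram.mirrorMirror.chebyshevBracket_eq n
  have h2 : invX ((-1) ^ n * RatFunc.X ^ (n ^ 2 + 2 * n)) =
      ((-1) ^ n * RatFunc.X ^ (n ^ 2 + 2 * n))⁻¹ := by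
    rw [map_mul, map_pow, map_pow, map_neg, map_one, invX_X, mul_inv, ← inv_pow, inv_neg, inv_one,
      inv_pow]
  rw [G, G, map_mul, map_mul, map_zpow₀, map_zpow₀, h1, h2, writhe_mirror, map_neg, map_one,
    inv_zpow', neg_neg]

theorem dMin_eq_hMin_iff (n : ℕ) :
    D.dMin n = (D.hMin n : WithTop ℤ) ↔ D.mirror.dMax n = (D.mirror.hMax n : WithBot ℤ) := by
  rw [dMin, minDegree_eq_iff, dMax, G_mirror, hMax_mirror]

theorem dMin_eq_hMin_iff_bAdequate {n : ℕ} (hn : 2 ≤ n) :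
    D.dMin n = (D.hMin n : WithTop ℤ) ↔ D.BAdequate := by
  rw [dMin_eq_hMin_iff, D.mirror.dMax_eq_hMax_iff_aAdequate hn]
  exact D.toDiagram.mirrorMirror.bAdequate_iff.symm

end LinkDiagram

end

end LinkDiag

theorem theorem3p1 (D : LinkDiag.LinkDiagram) :
    ((D.AAdequate ↔ ∃ n : ℕ, 2 ≤ n ∧ D.dMax n = (D.hMax n : WithBot ℤ)) ∧
      ((∀ n : ℕ, 2 ≤ n → D.dMax n = (D.hMax n : WithBot ℤ)) ↔
        D.dMax 2 = (D.hMax 2 : WithBot ℤ))) ∧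
    ((D.BAdequate ↔ ∃ n : ℕ, 2 ≤ n ∧ D.dMin n = (D.hMin n : WithTop ℤ)) ∧
      ((∀ n : ℕ, 2 ≤ n → D.dMin n = (D.hMin n : WithTop ℤ)) ↔
        D.dMin 2 = (D.hMin 2 : WithTop ℤ))) := by
  -- For each `n ≥ 2` the equality of degrees is equivalent to adequacy, which does not involve `n`;
  -- hence any one value of `n` decides all others.
  have hA := fun {n : ℕ} (hn : 2 ≤ n) => D.dMax_eq_hMax_iff_aAdequate hn
  have hB := fun {n : ℕ} (hn : 2 ≤ n) => D.dMin_eq_hMin_iff_bAdequate hn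
  exact ⟨⟨⟨fun h => ⟨2, le_rfl, (hA le_rfl).2 h⟩, fun ⟨_, hn, h⟩ => (hA hn).1 h⟩,
      fun h => h 2 le_rfl, fun h _ hn => (hA hn).2 ((hA le_rfl).1 h)⟩,
    ⟨fun h => ⟨2, le_rfl, (hB le_rfl).2 h⟩, fun ⟨_, hn, h⟩ => (hB hn).1 h⟩,
      fun h => h 2 le_rfl, fun h _ hn => (hB hn).2 ((hB le_rfl).1 h)⟩
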